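/- For $\theta\in[0,1]$ and a binary sequence $y\in\{0,1\}^\ell$ with $\ell_1$ ones and $\ell_0$ zeros let $p_\theta(y)=\theta^{\ell_1}(1-\theta)^{\ell_0}$ (memoryless binary source), and for a training sequence $x^n=(x_1,\dots,x_n)$ of $n$ batches $x_i\in\{0,1\}^\ell$ let $p_\theta(x^n)=\prod_{i=1}^n p_\theta(x_i)$. A predictor $\hat p$ assigns to each $x^n$ a probability distribution $\hat p(\cdot\mid x^n)$ on $\{0,1\}^\ell$; its batch regret is $$R(\hat p,\theta)=\sum_{x^n}p_\theta(x^n)\sum_{y\in\{0,1\}^\ell}p_\theta(y)\log\frac{p_\theta(y)}{\hat p(y\mid x^n)}\in[0,\infty],$$ with the conventions $0\log\frac{0}{q}=0$, $p\log\frac{p}{0}=+\infty$ for $p>0$, and $0\cdot\infty=0$. For $\beta>0$ the conditional add-$\beta$ predictor is $\hat p_\beta(y\mid x^n)=\prod_{i=1}^{\ell}\hat p_\beta(y_i\mid x^n,y^{i-1})$, where $$\hat p_\beta(y_i=1\mid x^n,y^{i-1})=\frac{t_1+\ell_1^{(i-1)}+\beta}{n\ell+i-1+2\beta},$$ $t_1$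 is the number of ones in $x^n$, and $\ell_1^{(i-1)}$ is the number of ones in $y^{i-1}=(y_1,\dots,y_{i-1})$. Let $\gamma>0$ and let $\ell=\ell(n)$ be a sequence of natural numbers with $\ell=\Theta(n^\gamma)$ as $n\to\infty$. Then, as $n\to\infty$, $$\min_{\hat p}\max_{\theta\in[0,1]}R(\hat p,\theta)\ \ge\ \frac12\log\Bigl(1+\frac1n\Bigr)+O\Bigl(\frac{\log(n\ell)}{n\ell}\Bigr).$$ Moreover, the conditional add-constant predictors are asymptotically optimal away from the endpoints: for every $\beta\in[\frac12,1]$, every $\delta\in(0,\frac12)$ and every $\varepsilon>0$, for all sufficiently large $n$, $$\max_{\theta\in[\delta,1-\delta]}R(\hat p_\beta,\theta)\ \le\ (1+\varepsilon)\,\min_{\hat p}\max_{\theta\in[\delta,1-\delta]}R(\hat p,\theta).$$ -/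

import Mathlib

open Filter Asymptotics

noncomputable section

namespace BatchPrediction

/-- A batch of `ℓ` binary samples (`true` is the symbol `1`, `false` the symbol `0`). -/
abbrev Batch (ℓ : ℕ) : Type := Fin ℓ → Bool

/-- A sequence of `n` training batches, each of `ℓ` binary samples. -/
abbrev Training (n ℓ : ℕ) : Type := Fin n → Batch ℓ

/-- The number of ones in a batch. -/
def ones {ℓ : ℕ} (y : Batch ℓ) : ℕ := (Finset.univ.filter fun j => y j = true).card

/-- The number of zeros in a batch. -/
def zeros {ℓ : ℕ} (y : Batch ℓ) : ℕ := (Finset.univ.filter fun j => y j = false).card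

/-- The probability of a batch under the memoryless source with parameter `θ`. -/
def prob (θ : ℝ) {ℓ : ℕ} (y : Batch ℓ) : ℝ := θ ^ ones y * (1 - θ) ^ zeros y

/-- The probability of `n` independent training batches under the source `θ`. -/
def trainProb (θ : ℝ) {n ℓ : ℕ} (x : Training n ℓ) : ℝ := ∏ i, prob θ (x i)

/-- Predictors: each training sequence `x` is sent to a probability vector `p x` on the
possible test batches. -/
def predictors (n ℓ : ℕ) : Set (Training n ℓ → Batch ℓ → ℝ) :=
  {p | ∀ x, p x ∈ stdSimplex ℝ (Batch ℓ)}

/-- The extended-real logarithm of `a / b`, for `a, b ≥ 0`; it is `⊤` when `a > 0 = b`, and `⊥`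
when `a = 0`. -/
def logRatio (a b : ℝ) : EReal := ENNReal.log (ENNReal.ofReal a / ENNReal.ofReal b)

/-- The batch regret of the predictor `p` for the source `θ`. In `EReal` we have
`0 * ⊤ = 0 * ⊥ = 0`, so terms with `prob θ y = 0` vanish. The regret is infinite exactly when a
test batch of positive probability gets predicted probability `0` after a training sequence of
positive probability. -/
def regret {n ℓ : ℕ} (p : Training n ℓ → Batch ℓ → ℝ) (θ : ℝ) : EReal :=
  ∑ x, (trainProb θ x : EReal) *
    ∑ y, (prob θ y : EReal) * logRatio (prob θ y) (p x y)

/-- The maximal batch regret of `p` over the sources with parameter in `Θ`. -/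
def maxRegret (Θ : Set ℝ) {n ℓ : ℕ} (p : Training n ℓ → Batch ℓ → ℝ) : EReal :=
  ⨆ θ ∈ Θ, regret p θ

/-- The minimax batch regret, for parameters in `Θ`. -/
def minimaxRegret (Θ : Set ℝ) (n ℓ : ℕ) : EReal :=
  ⨅ p ∈ predictors n ℓ, maxRegret Θ p

/-- The number of ones in all the training batches. -/
def trainOnes {n ℓ : ℕ} (x : Training n ℓ) : ℕ := ∑ i, ones (x i)

/-- The number of ones among the samples of `y` strictly before time `i`. -/
def onesBefore {ℓ : ℕ} (y : Batch ℓ) (i : Fin ℓ) : ℕ :=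
  (Finset.univ.filter fun j => j < i ∧ y j = true).card

/-- The probability that the conditional add-`β` predictor gives to a `1` at time `i` of the test
batch, given the training batches and the samples of `y` before time `i`. Times start at `0`,
so `i` test samples have been seen. -/
def addConstStep (β : ℝ) {n ℓ : ℕ} (x : Training n ℓ) (y : Batch ℓ) (i : Fin ℓ) : ℝ :=
  ((trainOnes x : ℝ) + onesBefore y i + β) / ((n : ℝ) * ℓ + (i : ℕ) + 2 * β)

/-- The conditional add-`β` predictor. -/
def addConst (β : ℝ) (n ℓ : ℕ) (x : Training n ℓ) (y : Batch ℓ) : ℝ :=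
  ∏ i, if y i = true then addConstStep β x y i else 1 - addConstStep β x y i

theorem sum_sequential (c : ℕ → ℕ → ℝ) (ℓ : ℕ) :
    ∑ y : Batch ℓ, ∏ i : Fin ℓ, (if y i = true then c i (onesBefore y i)
      else 1 - c i (onesBefore y i)) = 1 := by
  induction ℓ with
  | zero => simp
  | succ ℓ ih =>
    have hcs : ∀ (y : Batch ℓ) (b : Bool) (i : Fin ℓ),
        onesBefore (Fin.snoc (α := fun _ => Bool) y b) i.castSucc = onesBefore y i := by
      intro y b i
      simp only [onesBefore, Finset.card_filter]
      rw [Fin.sum_univ_castSucc]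
      simp [Fin.le_last]
    have hl : ∀ (y : Batch ℓ) (b : Bool),
        onesBefore (Fin.snoc (α := fun _ => Bool) y b) (Fin.last ℓ) = ones y := by
      intro y b
      simp only [onesBefore, ones, Finset.card_filter]
      rw [Fin.sum_univ_castSucc]
      simp [Fin.castSucc_lt_last]
    rw [← (Fin.snocEquiv (fun _ : Fin (ℓ + 1) => Bool)).sum_comp, Fintype.sum_prod_type_right]
    refine Eq.trans ?_ ih
    refine Finset.sum_congr rfl fun y _ => ?_
    simp only [Fin.snocEquiv, Equiv.coe_fn_mk, Fin.prod_univ_castSucc, Fin.snoc_castSucc,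
      Fin.snoc_last, hcs, hl, Fintype.sum_bool, Fin.val_castSucc]
    simp only [if_true, Bool.false_eq_true, if_false]
    ring

/-- The conditional add-`β` predictor is a predictor. -/
theorem addConst_mem_predictors {β : ℝ} (hβ : 0 < β) (n ℓ : ℕ) :
    addConst β n ℓ ∈ predictors n ℓ := by
  intro x
  have ht : (trainOnes x : ℝ) ≤ (n : ℝ) * ℓ := by
    have h : trainOnes x ≤ n * ℓ := by
      calc trainOnes x ≤ ∑ _i : Fin n, ℓ := Finset.sum_le_sum fun i _ => by
            simpa [ones] using Finset.card_filter_le (Finset.univ : Finset (Fin ℓ)) _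
        _ = n * ℓ := by simp
    exact_mod_cast h
  have hb : ∀ (y : Batch ℓ) (i : Fin ℓ), (onesBefore y i : ℝ) ≤ (i : ℕ) := by
    intro y i
    have h : onesBefore y i ≤ (Finset.Iio i).card :=
      Finset.card_le_card fun j hj => by simp at hj ⊢; exact hj.1
    rw [Fin.card_Iio] at h
    exact_mod_cast h
  refine ⟨fun y => Finset.prod_nonneg fun i _ => ?_, ?_⟩
  · have h0 : (0 : ℝ) < (n : ℝ) * ℓ + (i : ℕ) + 2 * β := by positivity
    have h1 : 0 ≤ addConstStep β x y i := by unfold addConstStep; positivity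
    have h2 : addConstStep β x y i ≤ 1 := by
      unfold addConstStep
      rw [div_le_one h0]
      linarith [hb y i]
    split_ifs
    · exact h1
    · linarith
  · exact sum_sequential
      (fun i k => ((trainOnes x : ℝ) + k + β) / ((n : ℝ) * ℓ + i + 2 * β)) ℓ

end BatchPrediction

end

/-!
Write `N = n * ℓ` for the number of training samples. A count vector `(i, j)` (`i` ones, `j` zeros)
is sufficient, so all expectations reduce to binomial ones (`binExp`). Call `W : ℕ → ℕ → ℝ` an urn
weight if it is positive and `W (i + 1) j + W i (j + 1) = W i j`. The ratio of the weights after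
and before the test batch is then a predictor; both the add-`β` predictor (Pólya weights) and the
Bayes predictor of a prior `w` (with `W i j = ∫ w θ * θ ^ i * (1 - θ) ^ j`) have this form. For it
the regret telescopes (`IsUrnWeight.realRegret_eq`): it is the sum over `N ≤ m < N + ℓ` of the
expected Bernoulli divergence between `θ` and the estimate `W (i + 1) j / W i j` made from `m`
samples.

By Gibbs' inequality no predictor has a smaller average regret under the prior `w` than its Bayes
predictor, so a lower bound for the average of every summand gives one for the minimax regret
(`le_minimaxRegret_of_prior`).

* For the uniform prior on `[0, 1]` the estimate is `(i + 1) / (m + 2)` and `i` is uniformly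
  distributed on `{0, …, m}`; the average of a summand is thus the difference between a Riemann sum
  of the binary entropy and its integral. A sharp bound for `∑ k * log k` shows that it is at least
  `1 / (2 (m + 1)) - O(log m / m ^ 2)` (`uniform_step_ge`). Summing over `m` gives
  `log (1 + 1 / n) / 2` up to `O(log N / N)`.
* For parameters in `[δ, 1 - δ]`, take a prior that lives on a small interval around `1 / 2`. By
  Pinsker's inequality the divergence is at least `2 (q - θ) ^ 2`, and the van Trees inequality
  (`bayes_sq_risk_ge`) bounds the Bayes quadratic risk below by roughly `θ (1 - θ) / m ≈ 1 / (4 m)`.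
  As Pinsker's inequality is sharp at `1 / 2`, the summand is at least `(1 - ε) / (2 m)` for large
  `m`.
* In the other direction, a Taylor expansion of the divergence, together with the second and fourth
  central moments of the binomial distribution, shows that the summand of the add-`β` predictor is
  at most `(1 + ε) / (2 m)`, uniformly in `θ ∈ [δ, 1 - δ]` (`exists_addConst_step_le`).

The last two bounds agree term by term up to a factor close to `1`, which is the asymptotic
optimality.
-/

noncomputable section

namespace BatchPrediction

/-! ### Binomial expectations of functions of the counts -/

/-- The expectation of `f i j`, where `i` and `j` are the numbers of ones and zeros among `m`
samples of the memoryless source with parameter `θ`. Both counts are arguments of `f`, so that no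
natural-number subtraction occurs. -/
def binExp (θ : ℝ) (m : ℕ) (f : ℕ → ℕ → ℝ) : ℝ :=
  ∑ p ∈ Finset.HasAntidiagonal.antidiagonal m,
    (m.choose p.1 : ℝ) * (θ ^ p.1 * (1 - θ) ^ p.2 * f p.1 p.2)

theorem binExp_zero (θ : ℝ) (f : ℕ → ℕ → ℝ) : binExp θ 0 f = f 0 0 := by
  simp [binExp]

/-- Conditioning on the first `m` of `m + 1` samples. -/
theorem binExp_succ (θ : ℝ) (m : ℕ) (f : ℕ → ℕ → ℝ) :
    binExp θ (m + 1) f = binExp θ m fun i j => θ * f (i + 1) j + (1 - θ) * f i (j + 1) := by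
  simp only [binExp]
  rw [Finset.sum_antidiagonal_choose_succ_mul
    (fun i j => θ ^ i * (1 - θ) ^ j * f i j), ← Finset.sum_add_distrib]
  refine Finset.sum_congr rfl fun p hp => ?_
  rw [← Finset.HasAntidiagonal.mem_antidiagonal.1 hp, Nat.choose_symm_add]
  ring

theorem binExp_add_fun (θ : ℝ) (m : ℕ) (f g : ℕ → ℕ → ℝ) :
    binExp θ m (fun i j => f i j + g i j) = binExp θ m f + binExp θ m g := by
  simp only [binExp, ← Finset.sum_add_distrib]
  exact Finset.sum_congr rfl fun p _ => by ring

theorem binExp_const_mul (θ : ℝ) (m : ℕ) (c : ℝ) (f : ℕ → ℕ → ℝ) :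
    binExp θ m (fun i j => c * f i j) = c * binExp θ m f := by
  simp only [binExp, Finset.mul_sum]
  exact Finset.sum_congr rfl fun p _ => by ring

theorem binExp_sub_fun (θ : ℝ) (m : ℕ) (f g : ℕ → ℕ → ℝ) :
    binExp θ m (fun i j => f i j - g i j) = binExp θ m f - binExp θ m g := by
  simp only [binExp, ← Finset.sum_sub_distrib]
  exact Finset.sum_congr rfl fun p _ => by ring

theorem binExp_const (θ : ℝ) (m : ℕ) (c : ℝ) : binExp θ m (fun _ _ => c) = c := by
  induction m with
  | zero => simp [binExp_zero]
  | succ m ih =>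
    rw [binExp_succ, ← ih]
    congr 1
    funext i j
    rw [ih]; ring

theorem binExp_mono {θ : ℝ} (h0 : 0 ≤ θ) (h1 : θ ≤ 1) {m : ℕ} {f g : ℕ → ℕ → ℝ}
    (h : ∀ i j, i + j = m → f i j ≤ g i j) : binExp θ m f ≤ binExp θ m g := by
  refine Finset.sum_le_sum fun p hp => ?_
  have h2 : 0 ≤ 1 - θ := by linarith
  have := h p.1 p.2 (Finset.HasAntidiagonal.mem_antidiagonal.1 hp)
  gcongr

theorem binExp_add (θ : ℝ) (a b : ℕ) (f : ℕ → ℕ → ℝ) :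
    binExp θ (a + b) f =
      binExp θ a fun i j => binExp θ b fun i' j' => f (i + i') (j + j') := by
  induction b generalizing f with
  | zero => simp [binExp_zero]
  | succ b ih =>
    rw [← add_assoc, binExp_succ, ih]
    simp only [binExp_succ, add_assoc]

theorem ones_cons {ℓ : ℕ} (b : Bool) (y : Batch ℓ) :
    ones (Fin.cons (α := fun _ => Bool) b y) = (if b = true then 1 else 0) + ones y := by
  simp only [ones, Finset.card_filter, Fin.sum_univ_succ, Fin.cons_zero, Fin.cons_succ]

theorem zeros_cons {ℓ : ℕ} (b : Bool) (y : Batch ℓ) :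
    zeros (Fin.cons (α := fun _ => Bool) b y) = (if b = false then 1 else 0) + zeros y := by
  simp only [zeros, Finset.card_filter, Fin.sum_univ_succ, Fin.cons_zero, Fin.cons_succ]

theorem sum_prob_mul (θ : ℝ) (ℓ : ℕ) (f : ℕ → ℕ → ℝ) :
    ∑ y : Batch ℓ, prob θ y * f (ones y) (zeros y) = binExp θ ℓ f := by
  induction ℓ generalizing f with
  | zero => simp [binExp_zero, prob, ones, zeros]
  | succ ℓ ih =>
    rw [binExp_succ, ← ih, ← (Fin.consEquiv (fun _ : Fin (ℓ + 1) => Bool)).sum_comp,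
      Fintype.sum_prod_type_right]
    refine Finset.sum_congr rfl fun y _ => ?_
    simp only [Fin.consEquiv, Equiv.coe_fn_mk, Fintype.sum_bool, prob, ones_cons, zeros_cons]
    simp only [if_true, Bool.false_eq_true, Bool.true_eq_false, if_false, zero_add, pow_add,
      pow_one, add_comm 1]
    ring

/-- The number of zeros in all the training batches. -/
def trainZeros {n ℓ : ℕ} (x : Training n ℓ) : ℕ := ∑ i, zeros (x i)

theorem ones_add_zeros {ℓ : ℕ} (y : Batch ℓ) : ones y + zeros y = ℓ := by
  induction ℓ with
  | zero => simp [ones, zeros]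
  | succ ℓ ih =>
    rw [← Fin.cons_self_tail y, ones_cons, zeros_cons]
    have := ih (Fin.tail y)
    cases y 0 <;> simp <;> omega

theorem trainOnes_add_trainZeros {n ℓ : ℕ} (x : Training n ℓ) :
    trainOnes x + trainZeros x = n * ℓ := by
  simp [trainOnes, trainZeros, ← Finset.sum_add_distrib, ones_add_zeros]

theorem trainProb_eq (θ : ℝ) {n ℓ : ℕ} (x : Training n ℓ) :
    trainProb θ x = θ ^ trainOnes x * (1 - θ) ^ trainZeros x := by
  simp [trainProb, prob, trainOnes, trainZeros, Finset.prod_mul_distrib, Finset.prod_pow_eq_pow_sum]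

theorem sum_trainProb_mul (θ : ℝ) (n ℓ : ℕ) (f : ℕ → ℕ → ℝ) :
    ∑ x : Training n ℓ, trainProb θ x * f (trainOnes x) (trainZeros x) =
      binExp θ (n * ℓ) f := by
  induction n generalizing f with
  | zero => simp [binExp_zero, trainProb, trainOnes, trainZeros]
  | succ n ih =>
    rw [show (n + 1) * ℓ = ℓ + n * ℓ by ring, binExp_add, ← sum_prob_mul,
      ← (Fin.consEquiv (fun _ : Fin (n + 1) => Batch ℓ)).sum_comp, Fintype.sum_prod_type]
    refine Finset.sum_congr rfl fun y _ => ?_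
    simp only [← ih, Finset.mul_sum]
    refine Finset.sum_congr rfl fun x _ => ?_
    simp only [Fin.consEquiv, Equiv.coe_fn_mk, trainProb, trainOnes, trainZeros,
      Fin.prod_univ_succ, Fin.sum_univ_succ, Fin.cons_zero, Fin.cons_succ, mul_assoc]

theorem sum_prob (θ : ℝ) (ℓ : ℕ) : ∑ y : Batch ℓ, prob θ y = 1 := by
  simpa [binExp_const] using sum_prob_mul θ ℓ fun _ _ => 1

/-- The centred count `i - (i + j) * θ`, which is `θ * (1 - θ)` times the derivative of
`log (θ ^ i * (1 - θ) ^ j)`, the score of statistics. -/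
def score (θ : ℝ) (i j : ℕ) : ℝ := i * (1 - θ) - j * θ

theorem score_succ_left (θ : ℝ) (i j : ℕ) : score θ (i + 1) j = score θ i j + (1 - θ) := by
  simp only [score]; push_cast; ring

theorem score_succ_right (θ : ℝ) (i j : ℕ) : score θ i (j + 1) = score θ i j - θ := by
  simp only [score]; push_cast; ring

theorem binExp_score (θ : ℝ) (m : ℕ) : binExp θ m (score θ) = 0 := by
  induction m with
  | zero => simp [binExp_zero, score]
  | succ m ih =>
    rw [binExp_succ, ← ih]
    congr 1; funext i j
    rw [score_succ_left, score_succ_right]; ring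

theorem binExp_score_sq (θ : ℝ) (m : ℕ) :
    binExp θ m (fun i j => score θ i j ^ 2) = m * (θ * (1 - θ)) := by
  induction m with
  | zero => simp [binExp_zero, score]
  | succ m ih =>
    have h : ∀ i j, θ * score θ (i + 1) j ^ 2 + (1 - θ) * score θ i (j + 1) ^ 2 =
        score θ i j ^ 2 + θ * (1 - θ) := fun i j => by
      rw [score_succ_left, score_succ_right]; ring
    simp only [binExp_succ, h]
    rw [binExp_add_fun, ih, binExp_const]
    push_cast; ring

theorem binExp_score_pow_four_le {θ : ℝ} (h0 : 0 ≤ θ) (h1 : θ ≤ 1) (m : ℕ) :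
    binExp θ m (fun i j => score θ i j ^ 4) ≤ 3 * (m : ℝ) ^ 2 := by
  induction m with
  | zero => simp [binExp_zero, score]
  | succ m ih =>
    have h : ∀ i j, θ * score θ (i + 1) j ^ 4 + (1 - θ) * score θ i (j + 1) ^ 4 =
        score θ i j ^ 4 + (6 * (θ * (1 - θ))) * score θ i j ^ 2 +
          (4 * (θ * (1 - θ) * (1 - 2 * θ))) * score θ i j +
          θ * (1 - θ) * (1 - 3 * (θ * (1 - θ))) := fun i j => by
      rw [score_succ_left, score_succ_right]; ring
    simp only [binExp_succ, h]
    rw [binExp_add_fun, binExp_add_fun, binExp_add_fun, binExp_const_mul, binExp_const_mul,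
      binExp_score_sq, binExp_score, binExp_const]
    have ht0 : 0 ≤ θ * (1 - θ) := mul_nonneg h0 (by linarith)
    have ht1 : θ * (1 - θ) ≤ 1 / 4 := by nlinarith [sq_nonneg (θ - 1 / 2)]
    have hm : (0 : ℝ) ≤ m := m.cast_nonneg
    have : (θ * (1 - θ)) * (m * (θ * (1 - θ))) ≤ m := by
      have : (θ * (1 - θ)) * (θ * (1 - θ)) ≤ 1 := by nlinarith
      nlinarith
    push_cast
    nlinarith

/-! ### Regret of predictors given by urn weights -/

/-- No restriction on `θ` is needed, because `Real.log 0 = Real.log 1 = 0`. -/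
theorem log_pow_mul_pow (θ : ℝ) (i j : ℕ) :
    Real.log (θ ^ i * (1 - θ) ^ j) = i * Real.log θ + j * Real.log (1 - θ) := by
  by_cases h0 : θ = 0
  · subst h0; rcases Nat.eq_zero_or_pos i with rfl | hi
    · simp
    · simp [zero_pow hi.ne']
  by_cases h1 : 1 - θ = 0
  · have : θ = 1 := by linarith
    subst this
    rcases Nat.eq_zero_or_pos j with rfl | hj
    · simp
    · simp [zero_pow hj.ne']
  rw [Real.log_mul (pow_ne_zero _ h0) (pow_ne_zero _ h1), Real.log_pow, Real.log_pow]

theorem prob_nonneg {θ : ℝ} (h0 : 0 ≤ θ) (h1 : θ ≤ 1) {ℓ : ℕ} (y : Batch ℓ) : 0 ≤ prob θ y :=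
  mul_nonneg (pow_nonneg h0 _) (pow_nonneg (by linarith) _)

theorem prob_pos {θ : ℝ} (h0 : 0 < θ) (h1 : θ < 1) {ℓ : ℕ} (y : Batch ℓ) : 0 < prob θ y :=
  mul_pos (pow_pos h0 _) (pow_pos (by linarith) _)

theorem trainProb_pos {θ : ℝ} (h0 : 0 < θ) (h1 : θ < 1) {n ℓ : ℕ} (x : Training n ℓ) :
    0 < trainProb θ x :=
  Finset.prod_pos fun _ _ => prob_pos h0 h1 _

theorem ereal_coe_sum {ι : Type*} (s : Finset ι) (f : ι → ℝ) :
    ((∑ i ∈ s, f i : ℝ) : EReal) = ∑ i ∈ s, (f i : EReal) := by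
  classical
  induction s using Finset.induction_on with
  | empty => simp
  | insert a s ha ih => rw [Finset.sum_insert ha, Finset.sum_insert ha, EReal.coe_add, ih]

theorem ereal_sum_ne_bot {ι : Type*} (s : Finset ι) (f : ι → EReal) (h : ∀ i ∈ s, f i ≠ ⊥) :
    ∑ i ∈ s, f i ≠ ⊥ := by
  classical
  induction s using Finset.induction_on with
  | empty => simp
  | insert a s ha ih =>
    rw [Finset.sum_insert ha, Ne, EReal.add_eq_bot_iff, not_or]
    exact ⟨h a (by simp), ih fun i hi => h i (by simp [hi])⟩

theorem ereal_sum_eq_top {ι : Type*} (s : Finset ι) (f : ι → EReal) (h : ∀ i ∈ s, f i ≠ ⊥)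
    {a : ι} (ha : a ∈ s) (hf : f a = ⊤) : ∑ i ∈ s, f i = ⊤ := by
  classical
  rw [← Finset.sum_erase_add s f ha, hf]
  exact EReal.add_top_of_ne_bot
    (ereal_sum_ne_bot _ _ fun i hi => h i (Finset.mem_of_mem_erase hi))

/-- The regret as a real number, for predictors that give every test batch a positive
probability. -/
def realRegret {n ℓ : ℕ} (p : Training n ℓ → Batch ℓ → ℝ) (θ : ℝ) : ℝ :=
  ∑ x, trainProb θ x * ∑ y, prob θ y * (Real.log (prob θ y) - Real.log (p x y))

theorem coe_mul_logRatio {a b : ℝ} (ha : 0 ≤ a) (hb : 0 < b) :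
    (a : EReal) * logRatio a b = ((a * (Real.log a - Real.log b) : ℝ) : EReal) := by
  rcases ha.eq_or_lt with rfl | ha
  · simp
  · rw [logRatio, ← ENNReal.ofReal_div_of_pos hb, ENNReal.log_ofReal_of_pos (div_pos ha hb),
      Real.log_div ha.ne' hb.ne', EReal.coe_mul]

theorem regret_eq_realRegret {θ : ℝ} (h0 : 0 ≤ θ) (h1 : θ ≤ 1) {n ℓ : ℕ}
    {p : Training n ℓ → Batch ℓ → ℝ} (hp : ∀ x y, 0 < p x y) :
    regret p θ = realRegret p θ := by
  simp only [regret, realRegret, ereal_coe_sum, EReal.coe_mul]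
  refine Finset.sum_congr rfl fun x _ => ?_
  congr 1
  refine Finset.sum_congr rfl fun y _ => ?_
  rw [coe_mul_logRatio (prob_nonneg h0 h1 y) (hp x y), EReal.coe_mul]

theorem coe_mul_logRatio_ne_bot {a b : ℝ} (ha : 0 < a) (hb : 0 ≤ b) :
    (a : EReal) * logRatio a b ≠ ⊥ := by
  rcases hb.eq_or_lt with rfl | hb
  · simp [logRatio, ENNReal.div_zero, ha, EReal.coe_mul_top_of_pos]
  · rw [coe_mul_logRatio ha.le hb]; exact EReal.coe_ne_bot _

theorem coe_mul_ne_bot {a : ℝ} (ha : 0 < a) {S : EReal} (hS : S ≠ ⊥) : (a : EReal) * S ≠ ⊥ := by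
  induction S using EReal.rec with
  | bot => exact absurd rfl hS
  | coe r => rw [← EReal.coe_mul]; exact EReal.coe_ne_bot _
  | top => rw [EReal.coe_mul_top_of_pos ha]; simp

theorem regret_eq_top {θ : ℝ} (h0 : 0 < θ) (h1 : θ < 1) {n ℓ : ℕ}
    {p : Training n ℓ → Batch ℓ → ℝ} (hp : ∀ x y, 0 ≤ p x y) {x₀ : Training n ℓ} {y₀ : Batch ℓ}
    (hxy : p x₀ y₀ = 0) : regret p θ = ⊤ := by
  have hne : ∀ x, ∑ y, (prob θ y : EReal) * logRatio (prob θ y) (p x y) ≠ ⊥ := fun x =>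
    ereal_sum_ne_bot _ _ fun y _ => coe_mul_logRatio_ne_bot (prob_pos h0 h1 y) (hp x y)
  refine ereal_sum_eq_top _ _ (fun x _ => coe_mul_ne_bot (trainProb_pos h0 h1 x) (hne x))
    (Finset.mem_univ x₀) ?_
  have hy : 0 < prob θ y₀ := prob_pos h0 h1 y₀
  rw [ereal_sum_eq_top _ _ (fun y _ => coe_mul_logRatio_ne_bot (prob_pos h0 h1 y) (hp x₀ y))
    (Finset.mem_univ y₀), EReal.coe_mul_top_of_pos (trainProb_pos h0 h1 _)]
  rw [hxy, logRatio, ENNReal.ofReal_zero, ENNReal.div_zero (by simpa using hy),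
    ENNReal.log_top, EReal.coe_mul_top_of_pos hy]

/-- The Kullback–Leibler divergence between the Bernoulli distributions with parameters `θ` and `q`.
With `Real.log 0 = 0` this is right for `θ ∈ [0, 1]` and `q ∈ (0, 1)`. -/
def klBer (θ q : ℝ) : ℝ :=
  θ * (Real.log θ - Real.log q) + (1 - θ) * (Real.log (1 - θ) - Real.log (1 - q))

/-- Positive weights on pairs of counts such that `W (i + 1) j / W i j` and `W i (j + 1) / W i j` are
the probabilities that the next sample is a one and a zero. Up to normalization, `W i j` is the
probability of a sequence with `i` ones and `j` zeros under an exchangeable law. -/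
structure IsUrnWeight (W : ℕ → ℕ → ℝ) : Prop where
  pos : ∀ i j, 0 < W i j
  add : ∀ i j, W (i + 1) j + W i (j + 1) = W i j

namespace IsUrnWeight

variable {W : ℕ → ℕ → ℝ}

theorem one_sub_div (hW : IsUrnWeight W) (i j : ℕ) :
    1 - W (i + 1) j / W i j = W i (j + 1) / W i j := by
  have := (hW.pos i j).ne'
  field_simp
  linarith [hW.add i j]

theorem div_mem_Ioo (hW : IsUrnWeight W) (i j : ℕ) :
    W (i + 1) j / W i j ∈ Set.Ioo (0 : ℝ) 1 := by
  refine ⟨div_pos (hW.pos _ _) (hW.pos _ _), ?_⟩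
  have := div_pos (hW.pos i (j + 1)) (hW.pos i j)
  linarith [hW.one_sub_div i j]

end IsUrnWeight

/-- The predictor that conditions the exchangeable law with weights `W` on the training samples. -/
def urnPredictor (W : ℕ → ℕ → ℝ) (n ℓ : ℕ) (x : Training n ℓ) (y : Batch ℓ) : ℝ :=
  W (trainOnes x + ones y) (trainZeros x + zeros y) / W (trainOnes x) (trainZeros x)

/-- One more sample increases the divergence between the source and the law with weights `W` by the
expected divergence of the next-sample estimate. -/
theorem IsUrnWeight.binExp_step {W : ℕ → ℕ → ℝ} (hW : IsUrnWeight W) (θ : ℝ) (m : ℕ) :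
    binExp θ (m + 1) (fun i j => i * Real.log θ + j * Real.log (1 - θ) - Real.log (W i j)) =
      binExp θ m (fun i j => i * Real.log θ + j * Real.log (1 - θ) - Real.log (W i j)) +
        binExp θ m fun i j => klBer θ (W (i + 1) j / W i j) := by
  rw [binExp_succ, ← binExp_add_fun]
  congr 1; funext i j
  rw [klBer, hW.one_sub_div, Real.log_div (hW.pos _ _).ne' (hW.pos _ _).ne',
    Real.log_div (hW.pos _ _).ne' (hW.pos _ _).ne']
  push_cast
  ring

/-- The chain rule for the divergence: the regret is the sum of the expected divergences of the
successive next-sample estimates. -/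
theorem IsUrnWeight.realRegret_eq {W : ℕ → ℕ → ℝ} (hW : IsUrnWeight W) (n ℓ : ℕ) (θ : ℝ) :
    realRegret (urnPredictor W n ℓ) θ =
      ∑ r ∈ Finset.range ℓ, binExp θ (n * ℓ + r) fun i j => klBer θ (W (i + 1) j / W i j) := by
  set g : ℕ → ℕ → ℝ :=
    fun i j => i * Real.log θ + j * Real.log (1 - θ) - Real.log (W i j) with hg
  have h1 : realRegret (urnPredictor W n ℓ) θ = binExp θ (n * ℓ + ℓ) g - binExp θ (n * ℓ) g := by
    rw [binExp_add, ← binExp_sub_fun, ← sum_trainProb_mul]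
    refine Finset.sum_congr rfl fun x _ => ?_
    congr 1
    rw [← sum_prob_mul, ← one_mul (g _ _), ← sum_prob θ ℓ, Finset.sum_mul,
      ← Finset.sum_sub_distrib]
    refine Finset.sum_congr rfl fun y _ => ?_
    rw [urnPredictor, Real.log_div (hW.pos _ _).ne' (hW.pos _ _).ne', prob, log_pow_mul_pow]
    simp only [hg]
    push_cast
    ring
  have h2 : ∀ k, binExp θ (n * ℓ + k) g - binExp θ (n * ℓ) g =
      ∑ r ∈ Finset.range k, binExp θ (n * ℓ + r) fun i j => klBer θ (W (i + 1) j / W i j) := by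
    intro k
    induction k with
    | zero => simp
    | succ k ih => rw [Finset.sum_range_succ, ← ih, ← add_assoc, hW.binExp_step]; ring
  rw [h1, h2]

/-- A product of sequential probabilities `c i m` (given `i` ones among `m` samples) telescopes to a
ratio of the weights they generate. -/
theorem prod_sequential {c : ℕ → ℕ → ℝ} {W : ℕ → ℕ → ℝ} (hW : ∀ i j, W i j ≠ 0)
    (h1 : ∀ i j, W (i + 1) j = c i (i + j) * W i j)
    (h0 : ∀ i j, W i (j + 1) = (1 - c i (i + j)) * W i j) (s t ℓ : ℕ) (y : Batch ℓ) :
    ∏ i : Fin ℓ, (if y i = true then c (s + onesBefore y i) (s + t + i)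
      else 1 - c (s + onesBefore y i) (s + t + i)) = W (s + ones y) (t + zeros y) / W s t := by
  induction ℓ generalizing s t with
  | zero => simp [ones, zeros, hW]
  | succ ℓ ih =>
    obtain ⟨b, z, rfl⟩ : ∃ b z, y = Fin.cons (α := fun _ => Bool) b z :=
      ⟨y 0, Fin.tail y, (Fin.cons_self_tail y).symm⟩
    have hb0 : onesBefore (Fin.cons (α := fun _ => Bool) b z) 0 = 0 := by simp [onesBefore]
    have hbs : ∀ i : Fin ℓ, onesBefore (Fin.cons (α := fun _ => Bool) b z) i.succ =
        (if b = true then 1 else 0) + onesBefore z i := fun i => by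
      simp only [onesBefore, Finset.card_filter, Fin.sum_univ_succ, Fin.cons_zero, Fin.cons_succ,
        Fin.succ_lt_succ_iff, Fin.succ_pos, true_and]
    rw [Fin.prod_univ_succ, ones_cons, zeros_cons]
    simp only [Fin.cons_zero, Fin.cons_succ, hb0, hbs, Fin.val_zero, Fin.val_succ, add_zero]
    cases b
    · have := ih s (t + 1) z
      simp only [Bool.false_eq_true, if_false, zero_add, if_true]
      rw [show t + (1 + zeros z) = t + 1 + zeros z by ring]
      simp only [show ∀ i : Fin ℓ, s + t + ((i : ℕ) + 1) = s + (t + 1) + i from fun i => by ring,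
        this, h0]
      have := hW s t
      have h3 := hW s (t + 1)
      rw [h0] at h3
      field_simp [left_ne_zero_of_mul h3]
    · have := ih (s + 1) t z
      simp only [Bool.true_eq_false, if_false, zero_add, if_true]
      rw [show s + (1 + ones z) = s + 1 + ones z by ring]
      simp only [show ∀ i : Fin ℓ, s + t + ((i : ℕ) + 1) = s + 1 + t + i from fun i => by ring,
        ← add_assoc s 1, this, h1]
      have := hW s t
      have h3 := hW (s + 1) t
      rw [h1] at h3
      field_simp [left_ne_zero_of_mul h3]

/-- The probability that a Pólya urn with initial weights `β`, `β` yields a given sequence of `i` ones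
and `j` zeros. -/
def polyaWeight (β : ℝ) (i j : ℕ) : ℝ :=
  (∏ r ∈ Finset.range i, (r + β)) * (∏ r ∈ Finset.range j, (r + β)) /
    ∏ r ∈ Finset.range (i + j), (r + 2 * β)

theorem polyaWeight_pos {β : ℝ} (hβ : 0 < β) (i j : ℕ) : 0 < polyaWeight β i j := by
  unfold polyaWeight; positivity

theorem polyaWeight_succ_left {β : ℝ} (hβ : 0 < β) (i j : ℕ) :
    polyaWeight β (i + 1) j = (i + β) / ((i + j : ℕ) + 2 * β) * polyaWeight β i j := by
  unfold polyaWeight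
  rw [show i + 1 + j = i + j + 1 by ring, Finset.prod_range_succ, Finset.prod_range_succ]
  have : (((i + j : ℕ) : ℝ) + 2 * β) ≠ 0 := by positivity
  have : ∏ r ∈ Finset.range (i + j), ((r : ℝ) + 2 * β) ≠ 0 :=
    (Finset.prod_pos fun r _ => by positivity).ne'
  field_simp

theorem polyaWeight_succ_right {β : ℝ} (hβ : 0 < β) (i j : ℕ) :
    polyaWeight β i (j + 1) = (j + β) / ((i + j : ℕ) + 2 * β) * polyaWeight β i j := by
  unfold polyaWeight
  rw [show i + (j + 1) = i + j + 1 by ring, Finset.prod_range_succ, Finset.prod_range_succ]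
  have : (((i + j : ℕ) : ℝ) + 2 * β) ≠ 0 := by positivity
  have : ∏ r ∈ Finset.range (i + j), ((r : ℝ) + 2 * β) ≠ 0 :=
    (Finset.prod_pos fun r _ => by positivity).ne'
  field_simp

theorem isUrnWeight_polyaWeight {β : ℝ} (hβ : 0 < β) : IsUrnWeight (polyaWeight β) where
  pos := polyaWeight_pos hβ
  add i j := by
    rw [polyaWeight_succ_left hβ, polyaWeight_succ_right hβ]
    have : (((i + j : ℕ) : ℝ) + 2 * β) ≠ 0 := by positivity
    field_simp
    push_cast; ring

theorem addConst_eq_urnPredictor {β : ℝ} (hβ : 0 < β) (n ℓ : ℕ) :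
    addConst β n ℓ = urnPredictor (polyaWeight β) n ℓ := by
  funext x y
  rw [urnPredictor, ← prod_sequential (c := fun i m => (i + β) / ((m : ℕ) + 2 * β))
    (fun i j => (polyaWeight_pos hβ i j).ne') (polyaWeight_succ_left hβ)]
  · refine Finset.prod_congr rfl fun i _ => ?_
    have : ((trainOnes x + trainZeros x : ℕ) : ℝ) = n * ℓ := by
      rw [trainOnes_add_trainZeros]; push_cast; rfl
    push_cast at this
    simp only [addConstStep, Nat.cast_add, this]
  · intro i j
    rw [polyaWeight_succ_right hβ]
    have : (((i + j : ℕ) : ℝ) + 2 * β) ≠ 0 := by positivity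
    congr 1
    field_simp
    push_cast; ring

/-! ### Bayes lower bound for the minimax regret -/

/-- The probability of a given sequence of `i` ones and `j` zeros when `θ` has the (not necessarily
normalized) prior density `w` on `[a, b]`. -/
def priorWeight (w : ℝ → ℝ) (a b : ℝ) (i j : ℕ) : ℝ :=
  ∫ θ in a..b, w θ * (θ ^ i * (1 - θ) ^ j)

/-- Continuity holds at the endpoints of `[0, 1]` too, since `t * Real.log t` is continuous at `0`. -/
theorem continuous_realRegret {n ℓ : ℕ} (p : Training n ℓ → Batch ℓ → ℝ) :
    Continuous (realRegret p) := by
  have hprob : ∀ m (y : Batch m), Continuous fun θ : ℝ => prob θ y := fun m y => by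
    unfold prob; fun_prop
  have h : realRegret p = fun θ => ∑ x, trainProb θ x * ∑ y,
      (prob θ y * Real.log (prob θ y) - prob θ y * Real.log (p x y)) := by
    funext θ; simp only [realRegret, mul_sub]
  rw [h]
  refine continuous_finsetSum _ fun x _ => Continuous.mul
    (continuous_finsetProd _ fun i _ => hprob _ _) (continuous_finsetSum _ fun y _ => ?_)
  exact (Real.continuous_mul_log.comp (hprob _ y)).sub ((hprob _ y).mul continuous_const)

theorem continuous_binExp {m : ℕ} {f : ℝ → ℕ → ℕ → ℝ} (hf : ∀ i j, Continuous fun θ => f θ i j) :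
    Continuous fun θ => binExp θ m (f θ) := by
  unfold binExp
  refine continuous_finsetSum _ fun p _ => ?_
  have := hf p.1 p.2
  fun_prop

theorem continuous_klBer (q : ℝ) : Continuous fun θ => klBer θ q := by
  have h : (fun θ => klBer θ q) = fun θ => (θ * Real.log θ - θ * Real.log q) +
      ((1 - θ) * Real.log (1 - θ) - (1 - θ) * Real.log (1 - q)) := by
    funext θ; simp only [klBer]; ring
  rw [h]
  have h1 := Real.continuous_mul_log
  have h2 : Continuous fun θ : ℝ => (1 - θ) * Real.log (1 - θ) :=
    h1.comp (continuous_const.sub continuous_id)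
  fun_prop

section Prior

variable {w : ℝ → ℝ} {a b : ℝ}

theorem isUrnWeight_priorWeight (hw : Continuous w) (hab : a < b) (ha : 0 ≤ a) (hb : b ≤ 1)
    (hpos : ∀ θ ∈ Set.Ioo a b, 0 < w θ) : IsUrnWeight (priorWeight w a b) where
  pos i j := by
    refine intervalIntegral.intervalIntegral_pos_of_pos_on
      (Continuous.intervalIntegrable (by fun_prop) _ _) (fun θ hθ => ?_) hab
    have h1 : 0 < θ := ha.trans_lt hθ.1
    have h2 : 0 < 1 - θ := by linarith [hθ.2]
    have := hpos θ hθ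
    positivity
  add i j := by
    unfold priorWeight
    rw [← intervalIntegral.integral_add (Continuous.intervalIntegrable (by fun_prop) _ _)
      (Continuous.intervalIntegrable (by fun_prop) _ _)]
    congr 1; funext θ; ring

theorem trainProb_mul_prob (θ : ℝ) {n ℓ : ℕ} (x : Training n ℓ) (y : Batch ℓ) :
    trainProb θ x * prob θ y =
      θ ^ (trainOnes x + ones y) * (1 - θ) ^ (trainZeros x + zeros y) := by
  rw [trainProb_eq, prob, pow_add, pow_add]; ring

/-- The Bayes predictor of the prior `w` minimizes the average regret. -/
theorem integral_realRegret_urnPredictor_le (hw : Continuous w) (hab : a < b) (ha : 0 ≤ a)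
    (hb : b ≤ 1) (hpos : ∀ θ ∈ Set.Ioo a b, 0 < w θ) {n ℓ : ℕ}
    {p : Training n ℓ → Batch ℓ → ℝ} (hp : p ∈ predictors n ℓ) (hp0 : ∀ x y, 0 < p x y) :
    ∫ θ in a..b, w θ * realRegret (urnPredictor (priorWeight w a b) n ℓ) θ ≤
      ∫ θ in a..b, w θ * realRegret p θ := by
  set W := priorWeight w a b with hWdef
  have hW : IsUrnWeight W := isUrnWeight_priorWeight hw hab ha hb hpos
  have hcont : ∀ p' : Training n ℓ → Batch ℓ → ℝ,
      IntervalIntegrable (fun θ => w θ * realRegret p' θ) MeasureTheory.volume a b := fun p' =>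
    (hw.mul (continuous_realRegret p')).intervalIntegrable _ _
  rw [← sub_nonneg, ← intervalIntegral.integral_sub (hcont _) (hcont _)]
  set q := urnPredictor W n ℓ with hq
  have hq0 : ∀ x y, 0 < q x y := fun x y => div_pos (hW.pos _ _) (hW.pos _ _)
  have hpt : ∀ θ, w θ * realRegret p θ - w θ * realRegret q θ = ∑ x, ∑ y,
      (Real.log (q x y) - Real.log (p x y)) *
        (w θ * (θ ^ (trainOnes x + ones y) * (1 - θ) ^ (trainZeros x + zeros y))) := by
    intro θ
    rw [← mul_sub, realRegret, realRegret, ← Finset.sum_sub_distrib, Finset.mul_sum]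
    refine Finset.sum_congr rfl fun x _ => ?_
    rw [← mul_sub, ← Finset.sum_sub_distrib, Finset.mul_sum, Finset.mul_sum]
    refine Finset.sum_congr rfl fun y _ => ?_
    rw [← trainProb_mul_prob]; ring
  simp only [hpt]
  rw [intervalIntegral.integral_finsetSum
    fun x _ => Continuous.intervalIntegrable (by fun_prop) _ _]
  have hint : ∀ x : Training n ℓ, (∫ θ in a..b, ∑ y, (Real.log (q x y) - Real.log (p x y)) *
        (w θ * (θ ^ (trainOnes x + ones y) * (1 - θ) ^ (trainZeros x + zeros y)))) =
      ∑ y, (Real.log (q x y) - Real.log (p x y)) *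
        W (trainOnes x + ones y) (trainZeros x + zeros y) := by
    intro x
    rw [intervalIntegral.integral_finsetSum
      fun y _ => Continuous.intervalIntegrable (by fun_prop) _ _]
    simp only [intervalIntegral.integral_const_mul]
    rfl
  refine Finset.sum_nonneg fun x _ => ?_
  rw [hint]
  have hterm : ∀ y, W (trainOnes x + ones y) (trainZeros x + zeros y) -
      p x y * W (trainOnes x) (trainZeros x) ≤ (Real.log (q x y) - Real.log (p x y)) *
        W (trainOnes x + ones y) (trainZeros x + zeros y) := by
    intro y
    have h0 := hW.pos (trainOnes x) (trainZeros x)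
    have h1 := hW.pos (trainOnes x + ones y) (trainZeros x + zeros y)
    have h2 := Real.log_le_sub_one_of_pos (div_pos (hp0 x y) (hq0 x y))
    rw [Real.log_div (hp0 x y).ne' (hq0 x y).ne'] at h2
    have h3 : p x y / q x y * W (trainOnes x + ones y) (trainZeros x + zeros y) =
        p x y * W (trainOnes x) (trainZeros x) := by
      rw [hq, urnPredictor]; field_simp
    nlinarith
  refine le_trans ?_ (Finset.sum_le_sum fun y _ => hterm y)
  have hsum : ∑ y : Batch ℓ, W (trainOnes x + ones y) (trainZeros x + zeros y) =
      W (trainOnes x) (trainZeros x) := by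
    simp only [hWdef, priorWeight]
    rw [← intervalIntegral.integral_finsetSum
      fun y _ => Continuous.intervalIntegrable (by fun_prop) _ _]
    have h : ∀ θ : ℝ, θ ^ trainOnes x * (1 - θ) ^ trainZeros x =
        ∑ y : Batch ℓ, θ ^ (trainOnes x + ones y) * (1 - θ) ^ (trainZeros x + zeros y) := by
      intro θ
      simp only [← trainProb_mul_prob, ← Finset.mul_sum, sum_prob, trainProb_eq, mul_one]
    simp only [h, Finset.mul_sum]
  rw [Finset.sum_sub_distrib, ← Finset.sum_mul, (hp x).2, hsum]
  simp

/-- A lower bound `L m` for the average divergence of the Bayes estimate from `m` samples, for every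
`m` from `n * ℓ` on, gives a lower bound for the minimax regret. -/
theorem le_minimaxRegret_of_prior (hw : Continuous w) (hab : a < b) (ha : 0 ≤ a)
    (hb : b ≤ 1) (hpos : ∀ θ ∈ Set.Ioo a b, 0 < w θ) {Θ : Set ℝ} (hΘ : Set.Icc a b ⊆ Θ)
    {n ℓ : ℕ} {L : ℕ → ℝ}
    (hL : ∀ m, n * ℓ ≤ m → L m * ∫ θ in a..b, w θ ≤ ∫ θ in a..b, w θ *
      binExp θ m fun i j => klBer θ (priorWeight w a b (i + 1) j / priorWeight w a b i j)) :
    ((∑ r ∈ Finset.range ℓ, L (n * ℓ + r) : ℝ) : EReal) ≤ minimaxRegret Θ n ℓ := by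
  have hW := isUrnWeight_priorWeight hw hab ha hb hpos
  have hZ : 0 < ∫ θ in a..b, w θ := intervalIntegral.intervalIntegral_pos_of_pos_on
    (hw.intervalIntegrable _ _) hpos hab
  have hbayes : (∑ r ∈ Finset.range ℓ, L (n * ℓ + r)) * ∫ θ in a..b, w θ ≤
      ∫ θ in a..b, w θ * realRegret (urnPredictor (priorWeight w a b) n ℓ) θ := by
    simp only [hW.realRegret_eq, Finset.mul_sum]
    rw [intervalIntegral.integral_finsetSum, Finset.sum_mul]
    · exact Finset.sum_le_sum fun r _ => hL _ (by omega)
    · exact fun r _ => (hw.mul (continuous_binExp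
        fun i j => continuous_klBer _)).intervalIntegrable _ _
  refine le_iInf₂ fun p hp => ?_
  by_cases hp0 : ∀ x y, 0 < p x y
  · have hle : ∀ θ ∈ Set.Icc a b, (realRegret p θ : EReal) ≤ maxRegret Θ p := fun θ hθ => by
      rw [← regret_eq_realRegret (ha.trans hθ.1) (hθ.2.trans hb) hp0]
      exact le_iSup₂ (f := fun θ (_ : θ ∈ Θ) => regret p θ) θ (hΘ hθ)
    induction h : maxRegret Θ p using EReal.rec with
    | top => exact le_top
    | bot =>
      have := hle a (Set.left_mem_Icc.2 hab.le)
      rw [h] at this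
      exact absurd (le_bot_iff.1 this) (EReal.coe_ne_bot _)
    | coe s =>
      rw [EReal.coe_le_coe_iff]
      refine le_of_mul_le_mul_right (hbayes.trans <|
        (integral_realRegret_urnPredictor_le hw hab ha hb hpos hp hp0).trans ?_) hZ
      rw [← intervalIntegral.integral_const_mul]
      refine intervalIntegral.integral_mono_on_of_le_Ioo hab.le
        ((hw.mul (continuous_realRegret p)).intervalIntegrable _ _)
        ((continuous_const.mul hw).intervalIntegrable _ _) fun θ hθ => ?_
      have h1 := hle θ (Set.Ioo_subset_Icc_self hθ)
      rw [h, EReal.coe_le_coe_iff] at h1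
      have := hpos θ hθ
      nlinarith
  · push Not at hp0
    obtain ⟨x, y, hxy⟩ := hp0
    have hmid : (a + b) / 2 ∈ Set.Ioo a b := ⟨by linarith, by linarith⟩
    have htop : regret p ((a + b) / 2) = ⊤ :=
      regret_eq_top (by linarith) (by linarith) (fun x y => (hp x).1 y)
        (le_antisymm hxy ((hp x).1 y))
    refine le_top.trans (htop.symm.le.trans ?_)
    exact le_iSup₂ (f := fun θ (_ : θ ∈ Θ) => regret p θ) _ (hΘ (Set.Ioo_subset_Icc_self hmid))

end Prior

/-! ### The uniform prior -/

/-- The beta integral. -/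
theorem priorWeight_one (i j : ℕ) :
    priorWeight (fun _ => 1) 0 1 i j = (i.factorial * j.factorial : ℝ) / (i + j + 1).factorial := by
  induction j generalizing i with
  | zero =>
    simp only [priorWeight, one_mul, pow_zero, mul_one, integral_pow, Nat.factorial_zero,
      add_zero, Nat.factorial_succ]
    have : (i.factorial : ℝ) ≠ 0 := by positivity
    push_cast
    field_simp
    simp
  | succ j ih =>
    have hparts : ((i : ℝ) + 1) * priorWeight (fun _ => 1) 0 1 i (j + 1) =
        (j + 1) * priorWeight (fun _ => 1) 0 1 (i + 1) j := by
      rw [← sub_eq_zero]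
      simp only [priorWeight, one_mul, ← intervalIntegral.integral_const_mul]
      rw [← intervalIntegral.integral_sub (Continuous.intervalIntegrable (by fun_prop) _ _)
        (Continuous.intervalIntegrable (by fun_prop) _ _)]
      have hd : ∀ θ : ℝ, HasDerivAt (fun θ : ℝ => θ ^ (i + 1) * (1 - θ) ^ (j + 1))
          ((i + 1) * (θ ^ i * (1 - θ) ^ (j + 1)) - (j + 1) * (θ ^ (i + 1) * (1 - θ) ^ j)) θ := by
        intro θ
        refine ((hasDerivAt_pow (i + 1) θ).mul
          (((hasDerivAt_id θ).const_sub 1).pow (j + 1))).congr_deriv ?_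
        simp only [Pi.pow_apply, id, Nat.add_sub_cancel]
        push_cast
        ring
      rw [intervalIntegral.integral_eq_sub_of_hasDerivAt (fun θ _ => hd θ)
        (Continuous.intervalIntegrable (by fun_prop) _ _)]
      simp
    have h1 := ih (i + 1)
    rw [h1] at hparts
    have h2 : (i : ℝ) + 1 ≠ 0 := by positivity
    rw [← mul_right_inj' h2, hparts, show i + 1 + j + 1 = i + (j + 1) + 1 by ring,
      Nat.factorial_succ i, Nat.factorial_succ j]
    push_cast
    ring

/-- Laplace's rule of succession. -/
theorem priorWeight_one_step (i j : ℕ) :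
    priorWeight (fun _ => 1) 0 1 (i + 1) j / priorWeight (fun _ => 1) 0 1 i j =
      (i + 1) / (i + j + 2) := by
  rw [priorWeight_one, priorWeight_one, show i + 1 + j + 1 = i + j + 1 + 1 by ring,
    Nat.factorial_succ i, Nat.factorial_succ (i + j + 1)]
  have : (i.factorial : ℝ) ≠ 0 := by positivity
  have : (j.factorial : ℝ) ≠ 0 := by positivity
  have : ((i + j + 1).factorial : ℝ) ≠ 0 := by positivity
  push_cast
  field_simp
  ring

/-- Under the uniform prior the number of ones is uniformly distributed. -/
theorem choose_mul_priorWeight_one (i j : ℕ) :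
    ((i + j).choose i : ℝ) * priorWeight (fun _ => 1) 0 1 i j = 1 / (i + j + 1) := by
  have h := Nat.add_choose_mul_factorial_mul_factorial j i
  have h' : ((i + j).choose i : ℝ) * i.factorial * j.factorial = (i + j).factorial := by
    rw [add_comm, mul_right_comm] at h
    exact_mod_cast h
  rw [priorWeight_one, Nat.factorial_succ, ← mul_div_assoc, ← mul_assoc, h']
  have : ((i + j).factorial : ℝ) ≠ 0 := by positivity
  push_cast
  field_simp

theorem integral_mul_log_add_symm :
    ∫ θ in (0 : ℝ)..1, (θ * Real.log θ + (1 - θ) * Real.log (1 - θ)) = -(1 / 2) := by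
  have hc := Real.continuous_mul_log
  have hc' : Continuous fun θ : ℝ => (1 - θ) * Real.log (1 - θ) :=
    hc.comp (continuous_const.sub continuous_id)
  rw [intervalIntegral.integral_add (hc.intervalIntegrable _ _) (hc'.intervalIntegrable _ _),
    intervalIntegral.integral_comp_sub_left (fun x => x * Real.log x) 1]
  have h : ∫ θ in (0 : ℝ)..1, θ * Real.log θ = -(1 / 4) := by
    rw [intervalIntegral.integral_eq_sub_of_hasDerivAt_of_le zero_le_one
      (f := fun x => x * (x * Real.log x) / 2 - x ^ 2 / 4)]
    · simp
    · fun_prop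
    · intro x hx
      have hx0 : x ≠ 0 := hx.1.ne'
      refine ((((hasDerivAt_id x).mul (Real.hasDerivAt_mul_log hx0)).div_const 2).sub
        ((hasDerivAt_pow 2 x).div_const 4)).congr_deriv ?_
      simp only [id]
      push_cast
      ring
    · exact hc.intervalIntegrable _ _
  norm_num [h]

/-- The trapezoidal rule for `∫ x * log x`, with an error term of size `log n`. -/
theorem sum_mul_log_le (n : ℕ) :
    ∑ i ∈ Finset.range (n + 1), ((i : ℝ) + 1) * Real.log (i + 1) ≤
      (((n : ℝ) + 1) ^ 2 / 2 + (n + 1) / 2 + 1 / 8) * Real.log (n + 1) - (n + 1) ^ 2 / 4 + 1 / 4 := by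
  induction n with
  | zero => simp
  | succ n ih =>
    rw [Finset.sum_range_succ]
    refine (add_le_add_left ih _).trans ?_
    push_cast
    have hn : (0 : ℝ) < n + 1 := by positivity
    set x : ℝ := n + 1 with hx
    have hlog : Real.log (x + 1) = Real.log x + Real.log (1 + 1 / x) := by
      rw [← Real.log_mul hn.ne' (by positivity)]
      congr 1; field_simp
    -- The coefficient of `log x` is `(2 * x + 1) ^ 2 / 8`, which matches `2 / (2 * x + 1)`, a lower
    -- bound for `log (1 + 1 / x)`.
    have h2 := Real.le_log_one_add_of_nonneg (x := 1 / x) (by positivity)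
    have h3 : 2 * (1 / x) / (1 / x + 2) = 2 / (2 * x + 1) := by field_simp; ring
    rw [h3] at h2
    have h4 : (2 * x + 1) / 4 ≤ (x ^ 2 / 2 + x / 2 + 1 / 8) * Real.log (1 + 1 / x) := by
      have : (2 * x + 1) / 4 = (x ^ 2 / 2 + x / 2 + 1 / 8) * (2 / (2 * x + 1)) := by
        field_simp; ring
      rw [this]
      gcongr
    rw [hlog]
    nlinarith

theorem sum_div_mul_log_div_le (m : ℕ) :
    ∑ i ∈ Finset.range (m + 1), (((i : ℝ) + 1) / (m + 2)) * Real.log ((i + 1) / (m + 2)) ≤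
      -((m : ℝ) + 2) / 4 + (2 + Real.log (m + 2)) / (8 * (m + 2)) := by
  have h := sum_mul_log_le (m + 1)
  rw [Finset.sum_range_succ] at h
  have hm : (0 : ℝ) < m + 2 := by positivity
  have hsum : ∑ i ∈ Finset.range (m + 1), ((i : ℝ) + 1) = (m + 1) * (m + 2) / 2 := by
    clear h
    induction m with
    | zero => norm_num
    | succ m ih => rw [Finset.sum_range_succ, ih (by positivity)]; push_cast; ring
  have hterm : ∀ i : ℕ, (((i : ℝ) + 1) / (m + 2)) * Real.log ((i + 1) / (m + 2)) =
      (1 / (m + 2)) * ((i + 1) * Real.log (i + 1)) - Real.log (m + 2) / (m + 2) * (i + 1) := by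
    intro i
    rw [Real.log_div (by positivity) hm.ne']
    ring
  simp only [hterm, Finset.sum_sub_distrib, ← Finset.mul_sum, hsum]
  push_cast at h
  rw [show (m : ℝ) + 1 + 1 = m + 2 by ring] at h
  have h5 : ∑ i ∈ Finset.range (m + 1), ((i : ℝ) + 1) * Real.log (i + 1) ≤
      (((m : ℝ) + 2) ^ 2 / 2 - (m + 2) / 2 + 1 / 8) * Real.log (m + 2) - (m + 2) ^ 2 / 4 + 1 / 4 := by
    linarith
  have h6 := mul_le_mul_of_nonneg_left h5 (show 0 ≤ 1 / ((m : ℝ) + 2) by positivity)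
  refine (sub_le_sub_right h6 _).trans (le_of_eq ?_)
  field_simp
  ring

/-- The average divergence of the Bayes estimate from `m` samples under the uniform prior. -/
theorem uniform_step_ge (m : ℕ) :
    1 / (2 * ((m : ℝ) + 1)) - (2 + Real.log (m + 2)) / (4 * (m + 1) * (m + 2)) ≤
      ∫ θ in (0 : ℝ)..1, binExp θ m fun i j => klBer θ
        (priorWeight (fun _ => 1) 0 1 (i + 1) j / priorWeight (fun _ => 1) 0 1 i j) := by
  set W := priorWeight (fun _ => 1) 0 1 with hWdef
  have hW : IsUrnWeight W := isUrnWeight_priorWeight continuous_const one_pos le_rfl le_rfl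
    fun _ _ => one_pos
  have hpt : ∀ θ, (binExp θ m fun i j => klBer θ (W (i + 1) j / W i j)) =
      (θ * Real.log θ + (1 - θ) * Real.log (1 - θ)) -
        ∑ p ∈ Finset.HasAntidiagonal.antidiagonal m, (m.choose p.1 : ℝ) *
          (Real.log (W (p.1 + 1) p.2 / W p.1 p.2) * (θ ^ (p.1 + 1) * (1 - θ) ^ p.2) +
            Real.log (W p.1 (p.2 + 1) / W p.1 p.2) * (θ ^ p.1 * (1 - θ) ^ (p.2 + 1))) := by
    intro θ
    rw [← binExp_const θ m (θ * Real.log θ + (1 - θ) * Real.log (1 - θ)), binExp, binExp,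
      ← Finset.sum_sub_distrib]
    refine Finset.sum_congr rfl fun p _ => ?_
    rw [klBer, hW.one_sub_div]
    ring
  have hc : Continuous fun θ : ℝ => θ * Real.log θ + (1 - θ) * Real.log (1 - θ) :=
    Real.continuous_mul_log.add
      (Real.continuous_mul_log.comp (continuous_const.sub continuous_id))
  simp only [hpt]
  rw [intervalIntegral.integral_sub (hc.intervalIntegrable _ _)
    (Continuous.intervalIntegrable (by fun_prop) _ _), integral_mul_log_add_symm,
    intervalIntegral.integral_finsetSum
      fun y _ => Continuous.intervalIntegrable (by fun_prop) _ _]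
  have hp : ∀ p ∈ Finset.HasAntidiagonal.antidiagonal m, (∫ θ in (0 : ℝ)..1, (m.choose p.1 : ℝ) *
      (Real.log (W (p.1 + 1) p.2 / W p.1 p.2) * (θ ^ (p.1 + 1) * (1 - θ) ^ p.2) +
        Real.log (W p.1 (p.2 + 1) / W p.1 p.2) * (θ ^ p.1 * (1 - θ) ^ (p.2 + 1)))) =
      1 / (m + 1) * (((p.1 : ℝ) + 1) / (m + 2) * Real.log ((p.1 + 1) / (m + 2)) +
        ((p.2 : ℝ) + 1) / (m + 2) * Real.log ((p.2 + 1) / (m + 2))) := by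
    rintro ⟨i, j⟩ hp
    have hij : i + j = m := Finset.HasAntidiagonal.mem_antidiagonal.1 hp
    have hm : (m : ℝ) = i + j := by rw [← hij]; push_cast; rfl
    have hWi : ∀ i j, ∫ θ in (0 : ℝ)..1, θ ^ i * (1 - θ) ^ j = W i j := fun i j => by
      simp [hWdef, priorWeight]
    rw [intervalIntegral.integral_const_mul, intervalIntegral.integral_add
      (Continuous.intervalIntegrable (by fun_prop) _ _)
      (Continuous.intervalIntegrable (by fun_prop) _ _), intervalIntegral.integral_const_mul,
      intervalIntegral.integral_const_mul, hWi, hWi]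
    have hs : W (i + 1) j / W i j = (i + 1) / (i + j + 2) := priorWeight_one_step i j
    have hs' : W i (j + 1) / W i j = (j + 1) / (i + j + 2) := by
      rw [← hW.one_sub_div, hs]
      field_simp; ring
    have h0 := hW.pos i j
    have e1 : W (i + 1) j = (i + 1) / (i + j + 2) * W i j := by
      rw [← hs]; field_simp
    have e2 : W i (j + 1) = (j + 1) / (i + j + 2) * W i j := by
      rw [← hs']; field_simp
    have hch : ((i + j).choose i : ℝ) * W i j = 1 / (i + j + 1) :=
      choose_mul_priorWeight_one i j
    rw [hij] at hch
    simp only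
    rw [hs', hs, hm, ← hch, e1, e2]
    ring
  rw [Finset.sum_congr rfl hp, ← Finset.mul_sum, Finset.sum_add_distrib]
  have hs1 := Finset.Nat.sum_antidiagonal_eq_sum_range_succ
    (fun i _ => ((i : ℝ) + 1) / (m + 2) * Real.log ((i + 1) / (m + 2))) m
  have hs2 := Finset.Nat.sum_antidiagonal_swap
    (f := fun p : ℕ × ℕ => ((p.1 : ℝ) + 1) / (m + 2) * Real.log ((p.1 + 1) / (m + 2))) (n := m)
  simp only [Prod.fst_swap] at hs2
  rw [hs2, hs1]
  have h := sum_div_mul_log_div_le m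
  have h7 := mul_le_mul_of_nonneg_left (add_le_add h h)
    (show 0 ≤ 1 / ((m : ℝ) + 1) by positivity)
  refine le_trans (le_of_eq ?_) (sub_le_sub_left h7 _)
  field_simp
  ring

/-- The main terms add up to a logarithm. The error terms of size `log m / m ^ 2` are dominated by
the increments of `(4 + log (m + 1)) / (4 * (m + 1))`. -/
theorem sum_step_ge (N ℓ : ℕ) :
    1 / 2 * Real.log ((N + ℓ + 1) / (N + 1)) - (4 + Real.log (N + 1)) / (4 * (N + 1)) ≤
      ∑ r ∈ Finset.range ℓ, (1 / (2 * (((N + r : ℕ) : ℝ) + 1)) -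
        (2 + Real.log (((N + r : ℕ) : ℝ) + 2)) /
          (4 * (((N + r : ℕ) : ℝ) + 1) * (((N + r : ℕ) : ℝ) + 2))) := by
  have key : 1 / 2 * (Real.log (((N + ℓ : ℕ) : ℝ) + 1) - Real.log (N + 1)) -
      (4 + Real.log (N + 1)) / (4 * (N + 1)) +
        (4 + Real.log (((N + ℓ : ℕ) : ℝ) + 1)) / (4 * (((N + ℓ : ℕ) : ℝ) + 1)) ≤
      ∑ r ∈ Finset.range ℓ, (1 / (2 * (((N + r : ℕ) : ℝ) + 1)) -
        (2 + Real.log (((N + r : ℕ) : ℝ) + 2)) /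
          (4 * (((N + r : ℕ) : ℝ) + 1) * (((N + r : ℕ) : ℝ) + 2))) := by
    induction ℓ with
    | zero => simp
    | succ ℓ ih =>
      rw [Finset.sum_range_succ]
      refine le_trans ?_ (add_le_add_left ih _)
      have hx : (0 : ℝ) < ((N + ℓ : ℕ) : ℝ) + 1 := by positivity
      have hx1 : (1 : ℝ) ≤ ((N + ℓ : ℕ) : ℝ) + 1 := by
        have : (0 : ℝ) ≤ ((N + ℓ : ℕ) : ℝ) := Nat.cast_nonneg _
        linarith
      rw [show (((N + (ℓ + 1) : ℕ) : ℝ) + 1) = ((N + ℓ : ℕ) : ℝ) + 1 + 1 by push_cast; ring,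
        show (((N + ℓ : ℕ) : ℝ) + 2) = ((N + ℓ : ℕ) : ℝ) + 1 + 1 by ring]
      generalize ((N + ℓ : ℕ) : ℝ) + 1 = x at hx hx1
      have hl : Real.log (x + 1) - Real.log x ≤ 1 / x := by
        rw [← Real.log_div (by positivity) hx.ne']
        refine (Real.log_le_sub_one_of_pos (by positivity)).trans (le_of_eq ?_)
        field_simp; ring
      have e : (4 + Real.log x) / (4 * x) - (4 + Real.log (x + 1)) / (4 * (x + 1)) -
          (2 + Real.log (x + 1)) / (4 * x * (x + 1)) =
          (2 - (x + 1) * (Real.log (x + 1) - Real.log x)) / (4 * x * (x + 1)) := by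
        field_simp; ring
      have h8 : (x + 1) * (Real.log (x + 1) - Real.log x) ≤ 2 := by
        calc _ ≤ (x + 1) * (1 / x) := by gcongr
          _ ≤ 2 := by rw [mul_one_div, div_le_iff₀ hx]; linarith
      have h9 : 0 ≤ (2 - (x + 1) * (Real.log (x + 1) - Real.log x)) / (4 * x * (x + 1)) := by
        apply div_nonneg (by linarith); positivity
      have h10 : 1 / (2 * x) = 1 / 2 * (1 / x) := by field_simp
      rw [h10]
      linarith
  refine le_trans ?_ key
  have h0 : 0 ≤ Real.log (((N + ℓ : ℕ) : ℝ) + 1) := Real.log_nonneg (by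
    have : (0 : ℝ) ≤ ((N + ℓ : ℕ) : ℝ) := Nat.cast_nonneg _
    linarith)
  have h1 : 0 ≤ (4 + Real.log (((N + ℓ : ℕ) : ℝ) + 1)) / (4 * (((N + ℓ : ℕ) : ℝ) + 1)) := by
    positivity
  rw [Real.log_div (by positivity) (by positivity)]
  push_cast at h1 ⊢
  linarith

theorem le_minimaxRegret_unitInterval (n ℓ : ℕ) :
    ((1 / 2 * Real.log (((n : ℝ) * ℓ + ℓ + 1) / (n * ℓ + 1)) -
      (4 + Real.log (n * ℓ + 1)) / (4 * (n * ℓ + 1)) : ℝ) : EReal) ≤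
      minimaxRegret (Set.Icc 0 1) n ℓ := by
  refine le_trans ?_ (le_minimaxRegret_of_prior (w := fun _ => 1) (a := 0) (b := 1)
    continuous_const one_pos le_rfl le_rfl (fun _ _ => one_pos) subset_rfl
    (L := fun m => 1 / (2 * ((m : ℝ) + 1)) - (2 + Real.log (m + 2)) / (4 * (m + 1) * (m + 2)))
    fun m _ => ?_)
  · rw [EReal.coe_le_coe_iff]
    simpa using sum_step_ge (n * ℓ) ℓ
  · simpa using uniform_step_ge m

/-! ### Priors concentrated around one half -/

/-- Pinsker's inequality for Bernoulli distributions. -/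
theorem two_mul_sq_le_klBer {θ q : ℝ} (hθ : θ ∈ Set.Ioo (0 : ℝ) 1) (hq : q ∈ Set.Ioo (0 : ℝ) 1) :
    2 * (q - θ) ^ 2 ≤ klBer θ q := by
  set F : ℝ → ℝ := fun q => klBer θ q - 2 * (q - θ) ^ 2 with hF
  have hF0 : F θ = 0 := by simp [hF, klBer]
  have hd : ∀ x ∈ Set.Ioo (0 : ℝ) 1, HasDerivAt F
      ((x - θ) * ((1 - 4 * (x * (1 - x))) / (x * (1 - x)))) x := by
    intro x hx
    have hx0 : x ≠ 0 := hx.1.ne'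
    have hx1 : 1 - x ≠ 0 := by linarith [hx.2]
    have h1 := ((Real.hasDerivAt_log hx0).const_sub (Real.log θ)).const_mul θ
    have h2 := ((((hasDerivAt_id x).const_sub 1).log hx1).const_sub
      (Real.log (1 - θ))).const_mul (1 - θ)
    have h3 := ((((hasDerivAt_id x).sub_const θ).pow 2).const_mul 2)
    refine ((h1.add h2).sub h3).congr_deriv ?_
    simp only [id]
    field_simp
    push_cast
    ring
  have hnn : ∀ x ∈ Set.Ioo (0 : ℝ) 1, 0 ≤ (1 - 4 * (x * (1 - x))) / (x * (1 - x)) := by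
    intro x hx
    have : 0 < 1 - x := by linarith [hx.2]
    have := hx.1
    refine div_nonneg ?_ (by positivity)
    nlinarith [sq_nonneg (1 - 2 * x)]
  suffices F θ ≤ F q by rw [hF0] at this; simp only [hF] at this; linarith
  rcases le_total θ q with h | h
  · have hsub : Set.Icc θ q ⊆ Set.Ioo (0 : ℝ) 1 := fun x hx =>
      ⟨hθ.1.trans_le hx.1, hx.2.trans_lt hq.2⟩
    refine monotoneOn_of_deriv_nonneg (convex_Icc θ q)
      (fun x hx => (hd x (hsub hx)).continuousAt.continuousWithinAt)
      (fun x hx => (hd x (hsub (interior_subset hx))).differentiableAt.differentiableWithinAt)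
      (fun x hx => ?_) (Set.left_mem_Icc.2 h) (Set.right_mem_Icc.2 h) h
    have hx' := hsub (interior_subset hx)
    rw [(hd x hx').deriv]
    exact mul_nonneg (by linarith [(interior_subset hx).1]) (hnn x hx')
  · have hsub : Set.Icc q θ ⊆ Set.Ioo (0 : ℝ) 1 := fun x hx =>
      ⟨hq.1.trans_le hx.1, hx.2.trans_lt hθ.2⟩
    refine antitoneOn_of_deriv_nonpos (convex_Icc q θ)
      (fun x hx => (hd x (hsub hx)).continuousAt.continuousWithinAt)
      (fun x hx => (hd x (hsub (interior_subset hx))).differentiableAt.differentiableWithinAt)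
      (fun x hx => ?_) (Set.left_mem_Icc.2 h) (Set.right_mem_Icc.2 h) h
    have hx' := hsub (interior_subset hx)
    rw [(hd x hx').deriv]
    exact mul_nonpos_of_nonpos_of_nonneg (by linarith [(interior_subset hx).2]) (hnn x hx')

/-- The factor `θ * (1 - θ)` clears the denominators of the score. -/
theorem hasDerivAt_binWeight (θ : ℝ) (i j : ℕ) : HasDerivAt
    (fun θ : ℝ => θ ^ i * (1 - θ) ^ j * (θ * (1 - θ)))
    (θ ^ i * (1 - θ) ^ j * (score θ i j + (1 - 2 * θ))) θ := by
  have h : (fun θ : ℝ => θ ^ i * (1 - θ) ^ j * (θ * (1 - θ))) =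
      fun θ : ℝ => θ ^ (i + 1) * (1 - θ) ^ (j + 1) := by funext θ; ring
  rw [h]
  refine ((hasDerivAt_pow (i + 1) θ).mul
    (((hasDerivAt_id θ).const_sub 1).pow (j + 1))).congr_deriv ?_
  simp only [Pi.pow_apply, id, Nat.add_sub_cancel, score]
  push_cast
  ring

/-- A form of the van Trees inequality, for the unnormalized prior `v ^ 2` on `[a, b]` and any
estimate `c i j` of `θ` from `m` samples. The parameter `lam` is free; `lam = 1 / m` is nearly
optimal. -/
theorem bayes_sq_risk_ge {v v' : ℝ → ℝ} {a b : ℝ} (hv : ∀ θ, HasDerivAt v (v' θ) θ) (hv' : Continuous v')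
    (hab : a ≤ b) (ha0 : 0 ≤ a) (hb1 : b ≤ 1) (ha : v a = 0) (hb : v b = 0) (c : ℕ → ℕ → ℝ)
    (m : ℕ) (lam : ℝ) :
    (2 * lam - lam ^ 2 * m) * (∫ θ in a..b, v θ ^ 2 * (θ * (1 - θ))) -
        lam ^ 2 * (∫ θ in a..b, (2 * v' θ * (θ * (1 - θ)) + v θ * (1 - 2 * θ)) ^ 2) ≤
      ∫ θ in a..b, v θ ^ 2 * binExp θ m fun i j => (c i j - θ) ^ 2 := by
  have hvc : Continuous v := continuous_iff_continuousAt.2 fun θ => (hv θ).continuousAt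
  have hsc : ∀ i j, Continuous fun θ => score θ i j := fun i j => by unfold score; fun_prop
  -- `v * U` is the derivative of `v ^ 2 * θ ^ i * (1 - θ) ^ j * (θ * (1 - θ))`, divided by
  -- `θ ^ i * (1 - θ) ^ j`.
  set U : ℝ → ℕ → ℕ → ℝ := fun θ i j =>
    2 * v' θ * (θ * (1 - θ)) + v θ * (1 - 2 * θ) + v θ * score θ i j with hU
  have hUc : ∀ i j, Continuous fun θ => U θ i j := fun i j => by
    have := hsc i j; fun_prop
  -- Integration by parts; the boundary terms vanish because `v` does at `a` and `b`.
  have hparts : ∀ i j, ∫ θ in a..b, (c i j - θ) * (v θ * (θ ^ i * (1 - θ) ^ j * U θ i j)) =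
      ∫ θ in a..b, v θ ^ 2 * (θ * (1 - θ)) * (θ ^ i * (1 - θ) ^ j) := by
    intro i j
    have hUij := hUc i j
    rw [← sub_eq_zero, ← intervalIntegral.integral_sub
      (Continuous.intervalIntegrable (by fun_prop) _ _)
      (Continuous.intervalIntegrable (by fun_prop) _ _),
      intervalIntegral.integral_eq_sub_of_hasDerivAt
        (f := fun θ => (c i j - θ) * (v θ ^ 2 * (θ ^ i * (1 - θ) ^ j * (θ * (1 - θ)))))
        (fun θ _ => ?_) (Continuous.intervalIntegrable (by fun_prop) _ _)]
    · simp [ha, hb]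
    · refine (((hasDerivAt_id θ).const_sub (c i j)).mul
        (((hv θ).pow 2).mul (hasDerivAt_binWeight θ i j))).congr_deriv ?_
      simp only [hU, id, Pi.mul_apply, Pi.pow_apply]
      push_cast
      ring
  have hcross : ∫ θ in a..b, (binExp θ m fun i j => (c i j - θ) * (v θ * U θ i j)) =
      ∫ θ in a..b, v θ ^ 2 * (θ * (1 - θ)) := by
    have e1 : ∀ θ, (binExp θ m fun i j => (c i j - θ) * (v θ * U θ i j)) =
        ∑ p ∈ Finset.HasAntidiagonal.antidiagonal m, (m.choose p.1 : ℝ) *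
          ((c p.1 p.2 - θ) * (v θ * (θ ^ p.1 * (1 - θ) ^ p.2 * U θ p.1 p.2))) := fun θ =>
      Finset.sum_congr rfl fun p _ => by ring
    have e2 : ∀ θ, v θ ^ 2 * (θ * (1 - θ)) =
        ∑ p ∈ Finset.HasAntidiagonal.antidiagonal m, (m.choose p.1 : ℝ) *
          (v θ ^ 2 * (θ * (1 - θ)) * (θ ^ p.1 * (1 - θ) ^ p.2)) := fun θ => by
      conv_lhs => rw [← binExp_const θ m (v θ ^ 2 * (θ * (1 - θ)))]
      exact Finset.sum_congr rfl fun p _ => by ring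
    simp only [e1]
    rw [intervalIntegral.integral_finsetSum, intervalIntegral.integral_congr fun θ _ => e2 θ,
      intervalIntegral.integral_finsetSum]
    · refine Finset.sum_congr rfl fun p _ => ?_
      rw [intervalIntegral.integral_const_mul, intervalIntegral.integral_const_mul, hparts]
    · exact fun p _ => Continuous.intervalIntegrable (by fun_prop) _ _
    · intro p _
      have := hUc p.1 p.2
      exact Continuous.intervalIntegrable (by fun_prop) _ _
  have hinfo : ∀ θ, (binExp θ m fun i j => U θ i j ^ 2) =
      (2 * v' θ * (θ * (1 - θ)) + v θ * (1 - 2 * θ)) ^ 2 + m * (v θ ^ 2 * (θ * (1 - θ))) := by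
    intro θ
    have h : ∀ i j, U θ i j ^ 2 = (2 * v' θ * (θ * (1 - θ)) + v θ * (1 - 2 * θ)) ^ 2 +
        2 * (2 * v' θ * (θ * (1 - θ)) + v θ * (1 - 2 * θ)) * v θ * score θ i j +
        v θ ^ 2 * score θ i j ^ 2 := fun i j => by simp only [hU]; ring
    simp only [h]
    rw [binExp_add_fun, binExp_add_fun, binExp_const, binExp_const_mul, binExp_const_mul,
      binExp_score, binExp_score_sq]
    ring
  -- The Cauchy–Schwarz inequality enters as `2 * lam * x * y - lam ^ 2 * y ^ 2 ≤ x ^ 2`.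
  have hmono : ∀ θ ∈ Set.Icc a b, 2 * lam * (binExp θ m fun i j => (c i j - θ) * (v θ * U θ i j)) -
      lam ^ 2 * (binExp θ m fun i j => U θ i j ^ 2) ≤
        v θ ^ 2 * binExp θ m fun i j => (c i j - θ) ^ 2 := by
    intro θ hθ
    rw [← binExp_const_mul, ← binExp_const_mul, ← binExp_const_mul, ← binExp_sub_fun]
    refine binExp_mono (ha0.trans hθ.1) (hθ.2.trans hb1) fun i j _ => ?_
    nlinarith [sq_nonneg (v θ * (c i j - θ) - lam * U θ i j)]
  have hc1 : Continuous fun θ => binExp θ m fun i j => (c i j - θ) * (v θ * U θ i j) :=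
    continuous_binExp fun i j => by have := hUc i j; fun_prop
  have hc2 : Continuous fun θ => binExp θ m fun i j => U θ i j ^ 2 :=
    continuous_binExp fun i j => by have := hUc i j; fun_prop
  have hc3 : Continuous fun θ => binExp θ m fun i j => (c i j - θ) ^ 2 :=
    continuous_binExp fun i j => by fun_prop
  refine le_trans (le_of_eq ?_) (intervalIntegral.integral_mono_on hab
    (Continuous.intervalIntegrable (by fun_prop) _ _)
    (Continuous.intervalIntegrable (by fun_prop) _ _) hmono)
  rw [intervalIntegral.integral_sub (Continuous.intervalIntegrable (by fun_prop) _ _)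
    (Continuous.intervalIntegrable (by fun_prop) _ _), intervalIntegral.integral_const_mul,
    intervalIntegral.integral_const_mul, hcross]
  simp only [hinfo]
  rw [intervalIntegral.integral_add (Continuous.intervalIntegrable (by fun_prop) _ _)
    (Continuous.intervalIntegrable (by fun_prop) _ _), intervalIntegral.integral_const_mul]
  ring

/-- The prior is `((θ - a) * (b - θ)) ^ 2` on a short interval `[a, b]` centred at `1 / 2`, where both
Pinsker's inequality and the bound `θ * (1 - θ) ≤ 1 / 4` are nearly equalities. -/
theorem le_minimaxRegret_of_half {δ ε : ℝ} (hδ : δ ∈ Set.Ioo (0 : ℝ) (1 / 2)) (hε : 0 < ε) :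
    ∃ m₀ : ℕ, 0 < m₀ ∧ ∀ n ℓ : ℕ, m₀ ≤ n * ℓ →
      ((∑ r ∈ Finset.range ℓ, (1 - ε) / (2 * ((n * ℓ + r : ℕ) : ℝ)) : ℝ) : EReal) ≤
        minimaxRegret (Set.Icc δ (1 - δ)) n ℓ := by
  obtain ⟨η, hη0, hη1, hη2⟩ : ∃ η : ℝ, 0 < η ∧ η ≤ 1 / 2 - δ ∧ 8 * η ^ 2 ≤ ε := by
    refine ⟨min (1 / 2 - δ) (min 1 (ε / 8)), ?_, min_le_left _ _, ?_⟩
    · have := hδ.2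
      refine lt_min (by linarith) (lt_min one_pos (by linarith))
    · set η := min (1 / 2 - δ) (min 1 (ε / 8))
      have h1 : η ≤ 1 := (min_le_right _ _).trans (min_le_left _ _)
      have h2 : η ≤ ε / 8 := (min_le_right _ _).trans (min_le_right _ _)
      have h3 : 0 ≤ η := le_min (by linarith [hδ.2]) (le_min zero_le_one (by linarith))
      nlinarith
  set a := 1 / 2 - η with ha
  set b := 1 / 2 + η with hb
  have hδ0 := hδ.1
  have hab : a < b := by linarith
  have ha0 : 0 ≤ a := by linarith
  have hb1 : b ≤ 1 := by linarith
  set v : ℝ → ℝ := fun θ => (θ - a) * (b - θ) with hv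
  set v' : ℝ → ℝ := fun θ => a + b - 2 * θ with hv'
  have hd : ∀ θ, HasDerivAt v (v' θ) θ := fun θ => by
    refine (((hasDerivAt_id θ).sub_const a).mul ((hasDerivAt_id θ).const_sub b)).congr_deriv ?_
    simp only [hv', id]; ring
  have hvpos : ∀ θ ∈ Set.Ioo a b, 0 < v θ ^ 2 := fun θ hθ => by
    have : 0 < v θ := mul_pos (by linarith [hθ.1]) (by linarith [hθ.2])
    positivity
  have hvc : Continuous v := by fun_prop
  have hv'c : Continuous v' := by fun_prop
  set Z := ∫ θ in a..b, v θ ^ 2 with hZ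
  set T := ∫ θ in a..b, v θ ^ 2 * (θ * (1 - θ)) with hT
  set J := ∫ θ in a..b, (2 * v' θ * (θ * (1 - θ)) + v θ * (1 - 2 * θ)) ^ 2 with hJ
  have hZ0 : 0 < Z := intervalIntegral.intervalIntegral_pos_of_pos_on
    (Continuous.intervalIntegrable (by fun_prop) _ _) hvpos hab
  have hTZ : (1 / 4 - η ^ 2) * Z ≤ T := by
    rw [hZ, ← intervalIntegral.integral_const_mul]
    refine intervalIntegral.integral_mono_on hab.le
      (Continuous.intervalIntegrable (by fun_prop) _ _)
      (Continuous.intervalIntegrable (by fun_prop) _ _) fun θ hθ => ?_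
    have : 1 / 4 - η ^ 2 ≤ θ * (1 - θ) := by nlinarith [hθ.1, hθ.2]
    nlinarith [sq_nonneg (v θ)]
  obtain ⟨m₀, hm₀⟩ := exists_nat_ge (8 * J / (ε * Z))
  refine ⟨m₀ + 1, Nat.succ_pos _, fun n ℓ hnl => ?_⟩
  have hsub : Set.Icc a b ⊆ Set.Icc δ (1 - δ) := Set.Icc_subset_Icc (by linarith) (by linarith)
  refine le_minimaxRegret_of_prior (w := fun θ => v θ ^ 2) (L := fun m => (1 - ε) / (2 * (m : ℝ)))
    (by fun_prop) hab ha0 hb1 hvpos hsub fun m hm => ?_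
  have hW : IsUrnWeight (priorWeight (fun θ => v θ ^ 2) a b) :=
    isUrnWeight_priorWeight (by fun_prop) hab ha0 hb1 hvpos
  set c : ℕ → ℕ → ℝ := fun i j => priorWeight (fun θ => v θ ^ 2) a b (i + 1) j /
    priorWeight (fun θ => v θ ^ 2) a b i j with hc
  have hmpos : (0 : ℝ) < m := by
    have : 0 < m := by omega
    exact_mod_cast this
  have hmJ : 8 * J ≤ m * (ε * Z) := by
    have : 8 * J / (ε * Z) ≤ m := hm₀.trans (by
      have : m₀ ≤ m := by omega
      exact_mod_cast this)
    rwa [div_le_iff₀ (by positivity)] at this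
  have hvt := bayes_sq_risk_ge hd hv'c hab.le ha0 hb1 (by simp [hv]) (by simp [hv]) c m (1 / m)
  have hpin : 2 * (∫ θ in a..b, v θ ^ 2 * binExp θ m fun i j => (c i j - θ) ^ 2) ≤
      ∫ θ in a..b, v θ ^ 2 * binExp θ m fun i j => klBer θ (c i j) := by
    have hc1 : Continuous fun θ => binExp θ m fun i j => (c i j - θ) ^ 2 :=
      continuous_binExp fun i j => by fun_prop
    have hc2 : Continuous fun θ => binExp θ m fun i j => klBer θ (c i j) :=
      continuous_binExp fun i j => continuous_klBer _
    rw [← intervalIntegral.integral_const_mul]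
    refine intervalIntegral.integral_mono_on_of_le_Ioo hab.le
      (Continuous.intervalIntegrable (by fun_prop) _ _)
      (Continuous.intervalIntegrable (by fun_prop) _ _) fun θ hθ => ?_
    have h01 : θ ∈ Set.Ioo (0 : ℝ) 1 := ⟨ha0.trans_lt hθ.1, hθ.2.trans_le hb1⟩
    rw [mul_left_comm, ← binExp_const_mul]
    refine mul_le_mul_of_nonneg_left ?_ (sq_nonneg _)
    exact binExp_mono h01.1.le h01.2.le fun i j _ => two_mul_sq_le_klBer h01 (hW.div_mem_Ioo i j)
  refine le_trans ?_ hpin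
  refine le_trans ?_ (mul_le_mul_of_nonneg_left hvt zero_le_two)
  rw [← hZ, ← hT, ← hJ]
  have e : (2 * (1 / (m : ℝ)) - (1 / m) ^ 2 * m) * T - (1 / m) ^ 2 * J = (T - J / m) / m := by
    field_simp; ring
  rw [e]
  have h1 : J / m ≤ ε * Z / 8 := by rw [div_le_iff₀ hmpos]; linarith
  have h2 : (1 - ε) / 4 * Z ≤ T - J / m := by nlinarith
  calc (1 - ε) / (2 * m) * Z = 2 * (((1 - ε) / 4 * Z) / m) := by field_simp; ring
    _ ≤ 2 * ((T - J / m) / m) := by gcongr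

/-! ### Upper bound for the add-`β` predictors -/

/-- A second-order Taylor bound with quartic remainder. The coefficient of `u ^ 4` has to involve a
bound `Λ` for `-log (1 + u)`, since the latter is unbounded near `u = -1`. -/
theorem neg_log_one_add_le {u η Λ : ℝ} (hu : -1 < u) (hη : 0 < η) (hΛ : 0 ≤ Λ)
    (h : -Real.log (1 + u) ≤ Λ) :
    -Real.log (1 + u) ≤ -u + (1 / 2 + η) * u ^ 2 + (1 / η + 16 + 16 * Λ) * u ^ 4 := by
  have h4 : 0 ≤ u ^ 4 := by positivity
  have h4η : 0 ≤ 1 / η * u ^ 4 := by positivity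
  have h4Λ : 0 ≤ Λ * u ^ 4 := by positivity
  have h2η : 0 ≤ η * u ^ 2 := by positivity
  rcases lt_or_ge u (-(1 / 2)) with h1 | h1
  · have : 1 ≤ 16 * u ^ 4 := by nlinarith [sq_nonneg (u ^ 2 - 1 / 4)]
    nlinarith [sq_nonneg u]
  rcases lt_or_ge (1 / 2) u with h2 | h2
  · have h3 : 0 ≤ Real.log (1 + u) := Real.log_nonneg (by linarith)
    have : u ≤ 16 * u ^ 4 := by
      have : 1 ≤ 16 * u ^ 3 := by nlinarith [sq_nonneg (u - 1 / 2)]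
      nlinarith
    nlinarith [sq_nonneg u]
  · have habs : |-u| ≤ 1 / 2 := by rw [abs_neg]; exact abs_le.2 ⟨h1, h2⟩
    have h5 := Real.abs_log_sub_add_sum_range_le (x := -u) (by linarith) 2
    have h6 : |-u| ^ (2 + 1) / (1 - |-u|) ≤ 2 * |u| ^ 3 := by
      rw [div_le_iff₀ (by linarith)]
      rw [abs_neg] at habs ⊢
      norm_num only
      have : 0 ≤ |u| ^ 3 * (1 / 2 - |u|) := mul_nonneg (by positivity) (by linarith)
      linarith
    have h7 : 2 * |u| ^ 3 ≤ η * u ^ 2 + 1 / η * u ^ 4 := by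
      have : 0 ≤ η * u ^ 2 + 1 / η * u ^ 4 - 2 * |u| ^ 3 := by
        have e : η * u ^ 2 + 1 / η * u ^ 4 - 2 * |u| ^ 3 = η * (|u| - 1 / η * |u| ^ 2) ^ 2 := by
          rw [← sq_abs u, show u ^ 4 = (u ^ 2) ^ 2 by ring, ← sq_abs u]
          field_simp
          ring
        rw [e]; positivity
      linarith
    have h8 := (abs_le.1 (h5.trans h6)).1
    simp only [Finset.sum_range_succ, Finset.sum_range_zero, sub_neg_eq_add] at h8
    norm_num at h8
    nlinarith

/-- The linear terms of the two Taylor bounds cancel. -/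
theorem klBer_le {δ θ q η Λ : ℝ} (hδ : 0 < δ) (hθ : θ ∈ Set.Icc δ (1 - δ))
    (hq : q ∈ Set.Ioo (0 : ℝ) 1) (hη : 0 < η) (h1 : -Real.log q ≤ Λ)
    (h0 : -Real.log (1 - q) ≤ Λ) :
    klBer θ q ≤ (1 / 2 + η) / (θ * (1 - θ)) * (q - θ) ^ 2 +
      2 * (1 / η + 16 + 16 * Λ) / δ ^ 3 * (q - θ) ^ 4 := by
  have hθ0 : 0 < θ := hδ.trans_le hθ.1
  have hθ1 : 0 < 1 - θ := by linarith [hθ.2]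
  have hq0 := hq.1
  have hq1 : 0 < 1 - q := by linarith [hq.2]
  have hΛ : 0 ≤ Λ := le_trans (by linarith [Real.log_nonpos hq0.le hq.2.le]) h1
  have e1 : 1 + (q - θ) / θ = q / θ := by field_simp; ring
  have e0 : 1 + -(q - θ) / (1 - θ) = (1 - q) / (1 - θ) := by field_simp; ring
  have l1 : -Real.log (1 + (q - θ) / θ) = Real.log θ - Real.log q := by
    rw [e1, Real.log_div hq0.ne' hθ0.ne']; ring
  have l0 : -Real.log (1 + -(q - θ) / (1 - θ)) = Real.log (1 - θ) - Real.log (1 - q) := by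
    rw [e0, Real.log_div hq1.ne' hθ1.ne']; ring
  have b1 := neg_log_one_add_le (u := (q - θ) / θ) (Λ := Λ)
    (by have := div_pos hq0 hθ0; linarith) hη hΛ
    (by rw [l1]; linarith [Real.log_nonpos hθ0.le (by linarith)])
  have b0 := neg_log_one_add_le (u := -(q - θ) / (1 - θ)) (Λ := Λ)
    (by have := div_pos hq1 hθ1; linarith) hη hΛ
    (by rw [l0]; linarith [Real.log_nonpos hθ1.le (by linarith)])
  rw [l1] at b1
  rw [l0] at b0
  have hK : 0 ≤ (1 / η + 16 + 16 * Λ) * (q - θ) ^ 4 := by positivity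
  have c1 : 1 / θ ^ 3 ≤ 1 / δ ^ 3 := by
    have := hθ.1
    gcongr
  have c0 : 1 / (1 - θ) ^ 3 ≤ 1 / δ ^ 3 := by
    have : δ ≤ 1 - θ := by linarith [hθ.2]
    gcongr
  calc klBer θ q ≤ θ * (-((q - θ) / θ) + (1 / 2 + η) * ((q - θ) / θ) ^ 2 +
          (1 / η + 16 + 16 * Λ) * ((q - θ) / θ) ^ 4) +
        (1 - θ) * (-(-(q - θ) / (1 - θ)) + (1 / 2 + η) * (-(q - θ) / (1 - θ)) ^ 2 +
          (1 / η + 16 + 16 * Λ) * (-(q - θ) / (1 - θ)) ^ 4) :=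
        add_le_add (mul_le_mul_of_nonneg_left b1 hθ0.le) (mul_le_mul_of_nonneg_left b0 hθ1.le)
    _ = (1 / 2 + η) / (θ * (1 - θ)) * (q - θ) ^ 2 +
        ((1 / η + 16 + 16 * Λ) * (q - θ) ^ 4) * (1 / θ ^ 3 + 1 / (1 - θ) ^ 3) := by
        generalize 1 / η + 16 + 16 * Λ = K
        field_simp
        ring
    _ ≤ (1 / 2 + η) / (θ * (1 - θ)) * (q - θ) ^ 2 +
        ((1 / η + 16 + 16 * Λ) * (q - θ) ^ 4) * (1 / δ ^ 3 + 1 / δ ^ 3) := by gcongr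
    _ = _ := by ring

/-- The divergence of the add-`β` estimate is at most a polynomial of degree four in the score. -/
theorem klBer_polyaWeight_le {β δ θ η : ℝ} (hβ : 0 < β) (hδ : 0 < δ)
    (hθ : θ ∈ Set.Icc δ (1 - δ)) (hη : 0 < η) {m i j : ℕ} (hm : 0 < m) (hij : i + j = m) {K : ℝ}
    (hK : K = 1 / η + 16 + 16 * (Real.log m + Real.log ((1 + 2 * β) / β))) (hK0 : 0 ≤ K) :
    klBer θ (polyaWeight β (i + 1) j / polyaWeight β i j) ≤
      (1 / 2 + η) / (θ * (1 - θ) * m ^ 2) * score θ i j ^ 2 +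
      (1 / 2 + η) / (θ * (1 - θ) * m ^ 2) * (2 * (β * (1 - 2 * θ))) * score θ i j +
      16 * K / (δ ^ 3 * m ^ 4) * score θ i j ^ 4 +
      ((1 / 2 + η) / (θ * (1 - θ) * m ^ 2) * β ^ 2 + 16 * K / (δ ^ 3 * m ^ 4) * β ^ 4) := by
  have hm1 : (1 : ℝ) ≤ m := by exact_mod_cast hm
  have hm0 : (0 : ℝ) < m := by linarith
  have hθ0 : 0 < θ := hδ.trans_le hθ.1
  have hθ1 : 0 < 1 - θ := by linarith [hθ.2]
  have hτ : 0 < θ * (1 - θ) := mul_pos hθ0 hθ1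
  set Λ := Real.log m + Real.log ((1 + 2 * β) / β) with hΛdef
  have hmij : (m : ℝ) = i + j := by rw [← hij]; push_cast; rfl
  have hi : (0 : ℝ) ≤ i := Nat.cast_nonneg _
  have hj : (0 : ℝ) ≤ j := Nat.cast_nonneg _
  have hq : polyaWeight β (i + 1) j / polyaWeight β i j = (i + β) / (m + 2 * β) := by
    rw [polyaWeight_succ_left hβ, hij, mul_div_cancel_right₀ _ (polyaWeight_pos hβ i j).ne']
  have hq1 : 1 - ((i : ℝ) + β) / (m + 2 * β) = (j + β) / (m + 2 * β) := by
    rw [hmij]; field_simp; ring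
  have hlog : ∀ k : ℝ, 0 ≤ k → -Real.log ((k + β) / (m + 2 * β)) ≤ Λ := by
    intro k hk
    rw [hΛdef, ← Real.log_mul hm0.ne' (by positivity), ← Real.log_inv]
    refine Real.log_le_log (by positivity) ?_
    rw [inv_div]
    calc ((m : ℝ) + 2 * β) / (k + β) ≤ (m + 2 * β * m) / β :=
          div_le_div₀ (by positivity) (by nlinarith) hβ (by linarith)
      _ = m * ((1 + 2 * β) / β) := by ring
  have hmem := (isUrnWeight_polyaWeight hβ).div_mem_Ioo i j
  rw [hq] at hmem ⊢
  have h := klBer_le hδ hθ hmem hη (hlog i hi) (by rw [hq1]; exact hlog j hj)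
  set e := β * (1 - 2 * θ) with he
  have he1 : e ^ 2 ≤ β ^ 2 := by
    rw [he, mul_pow]
    have : (1 - 2 * θ) ^ 2 ≤ 1 := by nlinarith
    nlinarith [sq_nonneg β]
  have he4 : e ^ 4 ≤ β ^ 4 := by
    have := pow_le_pow_left₀ (sq_nonneg e) he1 2
    nlinarith
  have hd : ((i : ℝ) + β) / (m + 2 * β) - θ = (score θ i j + e) / (m + 2 * β) := by
    rw [score, he, hmij]; field_simp; ring
  have hs4 : (score θ i j + e) ^ 4 ≤ 8 * (score θ i j ^ 4 + e ^ 4) := by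
    have := Even.add_pow_le (n := 4) (by decide) (a := score θ i j) (b := e)
    norm_num at this
    exact this
  have h2 : (((i : ℝ) + β) / (m + 2 * β) - θ) ^ 2 ≤ (score θ i j + e) ^ 2 / m ^ 2 := by
    rw [hd, div_pow]
    gcongr
    linarith
  have h4 : (((i : ℝ) + β) / (m + 2 * β) - θ) ^ 4 ≤
      8 * (score θ i j ^ 4 + β ^ 4) / m ^ 4 := by
    rw [hd, div_pow]
    gcongr
    · linarith
    · linarith
  rw [← hK] at h
  calc _ ≤ _ := h
    _ ≤ (1 / 2 + η) / (θ * (1 - θ)) * ((score θ i j + e) ^ 2 / m ^ 2) +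
        2 * K / δ ^ 3 * (8 * (score θ i j ^ 4 + β ^ 4) / m ^ 4) := by gcongr
    _ = (1 / 2 + η) / (θ * (1 - θ) * m ^ 2) * score θ i j ^ 2 +
        (1 / 2 + η) / (θ * (1 - θ) * m ^ 2) * (2 * e) * score θ i j +
        16 * K / (δ ^ 3 * m ^ 4) * score θ i j ^ 4 +
        ((1 / 2 + η) / (θ * (1 - θ) * m ^ 2) * e ^ 2 + 16 * K / (δ ^ 3 * m ^ 4) * β ^ 4) := by
        field_simp
        ring
    _ ≤ _ := by gcongr

/-- The expected divergence of the add-`β` estimate from `m` samples, times `m`, is at most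
`1 / 2 + η + O(log m / m)`. -/
theorem addConst_step_le {β δ θ η : ℝ} (hβ : 0 < β) (hδ : 0 < δ) (hθ : θ ∈ Set.Icc δ (1 - δ))
    (hη : 0 < η) {m : ℕ} (hm : 0 < m) :
    (m : ℝ) * (binExp θ m fun i j => klBer θ (polyaWeight β (i + 1) j / polyaWeight β i j)) ≤
      1 / 2 + η + ((1 / 2 + η) * (β ^ 2 / δ ^ 2) + 16 * (3 + β ^ 4) / δ ^ 3 *
        (1 / η + 16 + 16 * (Real.log m + Real.log ((1 + 2 * β) / β)))) / m := by
  have hm1 : (1 : ℝ) ≤ m := by exact_mod_cast hm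
  have hm0 : (0 : ℝ) < m := by linarith
  have hθ0 : 0 < θ := hδ.trans_le hθ.1
  have hθ1 : 0 < 1 - θ := by linarith [hθ.2]
  have hτ : 0 < θ * (1 - θ) := mul_pos hθ0 hθ1
  set Λ := Real.log m + Real.log ((1 + 2 * β) / β) with hΛdef
  have hΛ : 0 ≤ Λ := add_nonneg (Real.log_nonneg hm1)
    (Real.log_nonneg (by rw [le_div_iff₀ hβ]; linarith))
  set K := 1 / η + 16 + 16 * Λ with hK
  have hK0 : 0 ≤ K := by positivity
  have hE := binExp_mono hθ0.le (by linarith)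
    fun i j hij => klBer_polyaWeight_le hβ hδ hθ hη (i := i) (j := j) hm hij hK hK0
  clear_value K Λ
  rw [binExp_add_fun, binExp_add_fun, binExp_add_fun, binExp_const, binExp_const_mul,
    binExp_const_mul, binExp_const_mul, binExp_score, binExp_score_sq] at hE
  have h4 := binExp_score_pow_four_le hθ0.le (by linarith) m
  have hτδ : δ ^ 2 ≤ θ * (1 - θ) := by nlinarith [hθ.1, hθ.2]
  have hb : (1 / 2 + η) / (θ * (1 - θ) * m ^ 2) * β ^ 2 ≤
      (1 / 2 + η) / (δ ^ 2 * m ^ 2) * β ^ 2 := by gcongr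
  generalize (binExp θ m fun i j => score θ i j ^ 4) = E₄ at hE h4
  have hc : 16 * K / (δ ^ 3 * m ^ 4) * E₄ + 16 * K / (δ ^ 3 * m ^ 4) * β ^ 4 ≤
      16 * K / (δ ^ 3 * m ^ 4) * ((3 + β ^ 4) * m ^ 2) := by
    rw [← mul_add]
    refine mul_le_mul_of_nonneg_left ?_ (by positivity)
    have : β ^ 4 ≤ β ^ 4 * m ^ 2 := le_mul_of_one_le_right (by positivity) (by nlinarith)
    linarith
  have hmain : (1 / 2 + η) / (θ * (1 - θ) * m ^ 2) * (m * (θ * (1 - θ))) = (1 / 2 + η) / m := by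
    field_simp
  rw [hmain, mul_zero, add_zero] at hE
  have hE' : (binExp θ m fun i j => klBer θ (polyaWeight β (i + 1) j / polyaWeight β i j)) ≤
      (1 / 2 + η) / m + (1 / 2 + η) / (δ ^ 2 * m ^ 2) * β ^ 2 +
        16 * K / (δ ^ 3 * m ^ 4) * ((3 + β ^ 4) * m ^ 2) := by
    refine hE.trans ?_
    rw [add_assoc, add_assoc]
    refine add_le_add_right ?_ _
    linarith
  refine (mul_le_mul_of_nonneg_left hE' hm0.le).trans (le_of_eq ?_)
  field_simp
  ring

theorem exists_addConst_step_le {β δ ε : ℝ} (hβ : 0 < β) (hδ : 0 < δ) (hε : 0 < ε) :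
    ∃ m₀ : ℕ, ∀ m, m₀ ≤ m → ∀ θ ∈ Set.Icc δ (1 - δ),
      (binExp θ m fun i j => klBer θ (polyaWeight β (i + 1) j / polyaWeight β i j)) ≤
        (1 + ε) / (2 * (m : ℝ)) := by
  have hη : 0 < ε / 4 := by linarith
  have hlog : Tendsto (fun m : ℕ => Real.log m / m) atTop (nhds 0) :=
    Real.isLittleO_log_id_atTop.tendsto_div_nhds_zero.comp tendsto_natCast_atTop_atTop
  have hinv : Tendsto (fun m : ℕ => (1 : ℝ) / m) atTop (nhds 0) :=
    tendsto_one_div_atTop_nhds_zero_nat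
  have hlim : Tendsto (fun m : ℕ => ((1 / 2 + ε / 4) * (β ^ 2 / δ ^ 2) +
      16 * (3 + β ^ 4) / δ ^ 3 *
        (1 / (ε / 4) + 16 + 16 * (Real.log m + Real.log ((1 + 2 * β) / β)))) / (m : ℝ))
      atTop (nhds 0) := by
    have h := (hinv.const_mul ((1 / 2 + ε / 4) * (β ^ 2 / δ ^ 2) + 16 * (3 + β ^ 4) / δ ^ 3 *
      (1 / (ε / 4) + 16 + 16 * Real.log ((1 + 2 * β) / β)))).add
      (hlog.const_mul (16 * (3 + β ^ 4) / δ ^ 3 * 16))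
    rw [mul_zero, mul_zero, add_zero] at h
    refine h.congr fun m => ?_
    ring
  obtain ⟨m₀, hm₀⟩ := eventually_atTop.1 ((hlim.eventually_le_const hη).and
    (eventually_gt_atTop 0))
  refine ⟨m₀, fun m hm θ hθ => ?_⟩
  obtain ⟨h1, h2⟩ := hm₀ m hm
  have h3 := addConst_step_le hβ hδ hθ hη h2
  have hm0 : (0 : ℝ) < m := by exact_mod_cast h2
  rw [le_div_iff₀ (by positivity)]
  linarith

/-! ### Comparison of the bounds -/

theorem addConst_pos {β : ℝ} (hβ : 0 < β) {n ℓ : ℕ} (x : Training n ℓ) (y : Batch ℓ) :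
    0 < addConst β n ℓ x y := by
  rw [addConst_eq_urnPredictor hβ]
  exact div_pos (polyaWeight_pos hβ _ _) (polyaWeight_pos hβ _ _)

theorem maxRegret_addConst_le {β δ : ℝ} (hβ : 0 < β) (hδ : 0 < δ) {n ℓ : ℕ} {L : ℕ → ℝ}
    (hL : ∀ m, n * ℓ ≤ m → ∀ θ ∈ Set.Icc δ (1 - δ),
      (binExp θ m fun i j => klBer θ (polyaWeight β (i + 1) j / polyaWeight β i j)) ≤ L m) :
    maxRegret (Set.Icc δ (1 - δ)) (addConst β n ℓ) ≤
      ((∑ r ∈ Finset.range ℓ, L (n * ℓ + r) : ℝ) : EReal) := by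
  refine iSup₂_le fun θ hθ => ?_
  rw [regret_eq_realRegret (hδ.le.trans hθ.1) (by linarith [hθ.2])
    (addConst_pos hβ), addConst_eq_urnPredictor hβ,
    (isUrnWeight_polyaWeight hβ).realRegret_eq, EReal.coe_le_coe_iff]
  exact Finset.sum_le_sum fun r _ => hL _ (by omega) θ hθ

/-- Term by term, the upper bound `(1 + κ) / (2 * m)` is at most `1 + ε` times the lower bound
`(1 - κ) / (2 * m)`, for small `κ`. Only `n * ℓ` has to be large. -/
theorem maxRegret_addConst_le_minimaxRegret {β δ ε : ℝ} (hβ : 0 < β)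
    (hδ : δ ∈ Set.Ioo (0 : ℝ) (1 / 2)) (hε : 0 < ε) :
    ∃ m₀ : ℕ, ∀ n ℓ : ℕ, m₀ ≤ n * ℓ →
      maxRegret (Set.Icc δ (1 - δ)) (addConst β n ℓ) ≤
        ((1 + ε : ℝ) : EReal) * minimaxRegret (Set.Icc δ (1 - δ)) n ℓ := by
  obtain ⟨κ, hκ0, hκ⟩ : ∃ κ : ℝ, 0 < κ ∧ 1 + κ ≤ (1 + ε) * (1 - κ) := by
    refine ⟨ε / (2 + ε), by positivity, le_of_eq ?_⟩
    field_simp; ring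
  obtain ⟨m₁, hm₁, h₁⟩ := le_minimaxRegret_of_half hδ hκ0
  obtain ⟨m₂, h₂⟩ := exists_addConst_step_le hβ hδ.1 hκ0
  refine ⟨max m₁ m₂, fun n ℓ hnl => ?_⟩
  have hup := maxRegret_addConst_le (n := n) (ℓ := ℓ) (L := fun m => (1 + κ) / (2 * (m : ℝ)))
    hβ hδ.1 fun m hm θ hθ => h₂ m (((le_max_right _ _).trans hnl).trans hm) θ hθ
  have hlo := h₁ n ℓ ((le_max_left _ _).trans hnl)
  have hε0 : (0 : EReal) ≤ ((1 + ε : ℝ) : EReal) := by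
    rw [← EReal.coe_zero, EReal.coe_le_coe_iff]; linarith
  refine (hup.trans ?_).trans (mul_le_mul_of_nonneg_left hlo hε0)
  rw [← EReal.coe_mul, EReal.coe_le_coe_iff, Finset.mul_sum]
  refine Finset.sum_le_sum fun r _ => ?_
  rw [← mul_div_assoc]
  gcongr

theorem one_half_log_sub_le {n ℓ : ℕ} (hn : 0 < n) (hℓ : 0 < ℓ) :
    1 / 2 * Real.log (1 + 1 / (n : ℝ)) - 1 / (2 * ((n : ℝ) * ℓ)) ≤
      1 / 2 * Real.log (((n : ℝ) * ℓ + ℓ + 1) / (n * ℓ + 1)) := by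
  have hn' : (0 : ℝ) < n := by exact_mod_cast hn
  have hℓ' : (0 : ℝ) < ℓ := by exact_mod_cast hℓ
  have h1 : 1 + 1 / (n : ℝ) ≤ ((n : ℝ) * ℓ + ℓ + 1) / (n * ℓ + 1) * (1 + 1 / (n * ℓ)) := by
    have : ((n : ℝ) * ℓ + ℓ + 1) / (n * ℓ + 1) * (1 + 1 / (n * ℓ)) =
        1 + 1 / n + 1 / (n * ℓ) := by field_simp
    rw [this]
    have : 0 < 1 / ((n : ℝ) * ℓ) := by positivity
    linarith
  have h2 := Real.log_le_log (by positivity) h1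
  rw [Real.log_mul (by positivity) (by positivity)] at h2
  have h3 := Real.log_le_sub_one_of_pos (show 0 < 1 + 1 / ((n : ℝ) * ℓ) by positivity)
  have h4 : 1 / (2 * ((n : ℝ) * ℓ)) = 1 / 2 * (1 / (n * ℓ)) := by field_simp
  rw [h4]
  linarith

theorem error_isBigO {N : ℕ → ℝ} (hN : Tendsto N atTop atTop) :
    (fun n => -(1 / (2 * N n) + (4 + Real.log (N n + 1)) / (4 * (N n + 1)))) =O[atTop]
      fun n => Real.log (N n) / N n := by
  refine IsBigO.of_bound 3 ?_
  filter_upwards [hN.eventually_ge_atTop (Real.exp 1)] with n hn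
  generalize N n = x at hn
  have hx1 : 1 < x := lt_of_lt_of_le (by simp) hn
  have hx0 : 0 < x := by linarith
  have hlx : 1 ≤ Real.log x := by
    rw [Real.le_log_iff_exp_le hx0]; exact hn
  have hl1 : Real.log (x + 1) ≤ 1 + Real.log x := by
    have h := Real.log_le_log (by linarith) (show x + 1 ≤ 2 * x by linarith)
    rw [Real.log_mul two_ne_zero hx0.ne'] at h
    linarith [Real.log_two_lt_d9]
  have h0 : 0 ≤ Real.log (x + 1) := Real.log_nonneg (by linarith)
  rw [norm_neg, Real.norm_of_nonneg (by positivity), Real.norm_of_nonneg (by positivity)]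
  calc 1 / (2 * x) + (4 + Real.log (x + 1)) / (4 * (x + 1))
      ≤ Real.log x / (2 * x) + (4 * Real.log x + (Real.log x + Real.log x)) / (4 * x) := by
        gcongr <;> linarith
    _ ≤ 3 * (Real.log x / x) := by
        have : 0 < Real.log x / x := by positivity
        have e : Real.log x / (2 * x) + (4 * Real.log x + (Real.log x + Real.log x)) / (4 * x) =
          2 * (Real.log x / x) := by field_simp; ring
        rw [e]; linarith

end BatchPrediction

end

theorem theorem2 (γ : ℝ) (hγ : 0 < γ) (ℓ : ℕ → ℕ)
    (hℓ : (fun n : ℕ => (ℓ n : ℝ)) =Θ[atTop] fun n : ℕ => (n : ℝ) ^ γ) :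
    (∃ r : ℕ → ℝ,
      (r =O[atTop] fun n : ℕ => Real.log ((n : ℝ) * ℓ n) / ((n : ℝ) * ℓ n)) ∧
      ∀ᶠ n : ℕ in atTop,
        (((1 / 2 : ℝ) * Real.log (1 + 1 / (n : ℝ)) + r n : ℝ) : EReal) ≤
          BatchPrediction.minimaxRegret (Set.Icc 0 1) n (ℓ n)) ∧
    (∀ β ∈ Set.Icc (1 / 2 : ℝ) 1, ∀ δ ∈ Set.Ioo (0 : ℝ) (1 / 2), ∀ ε : ℝ, 0 < ε →
      ∀ᶠ n : ℕ in atTop,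
        BatchPrediction.maxRegret (Set.Icc δ (1 - δ)) (BatchPrediction.addConst β n (ℓ n)) ≤
          ((1 + ε : ℝ) : EReal) *
            BatchPrediction.minimaxRegret (Set.Icc δ (1 - δ)) n (ℓ n)) := by
  have hℓtop : Tendsto (fun n => (ℓ n : ℝ)) atTop atTop := by
    have h1 : Tendsto (fun n : ℕ => ‖(n : ℝ) ^ γ‖) atTop atTop :=
      tendsto_norm_atTop_atTop.comp ((tendsto_rpow_atTop hγ).comp tendsto_natCast_atTop_atTop)
    have h2 := (hℓ.tendsto_norm_atTop_iff).2 h1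
    exact h2.congr fun n => Real.norm_of_nonneg (Nat.cast_nonneg _)
  have hN : Tendsto (fun n : ℕ => (n : ℝ) * ℓ n) atTop atTop :=
    tendsto_natCast_atTop_atTop.atTop_mul_atTop₀ hℓtop
  have hℓpos : ∀ᶠ n in atTop, 0 < ℓ n := by
    filter_upwards [hℓtop.eventually_gt_atTop 0] with n hn
    exact_mod_cast hn
  refine ⟨⟨_, BatchPrediction.error_isBigO hN, ?_⟩, ?_⟩
  · filter_upwards [hℓpos, eventually_gt_atTop 0] with n hl hn
    refine le_trans ?_ (BatchPrediction.le_minimaxRegret_unitInterval n (ℓ n))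
    rw [EReal.coe_le_coe_iff]
    have := BatchPrediction.one_half_log_sub_le hn hl
    linarith
  · intro β hβ δ hδ ε hε
    obtain ⟨m₀, hm₀⟩ := BatchPrediction.maxRegret_addConst_le_minimaxRegret
      (show 0 < β by linarith [hβ.1]) hδ hε
    filter_upwards [hN.eventually_ge_atTop (m₀ : ℝ)] with n hn
    exact hm₀ n (ℓ n) (by exact_mod_cast hn)
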